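/- Let $M$ be a smooth (Hausdorff, second countable, finite-dimensional, boundaryless) manifold and $\hbar$ a formal variable. A linear differential operator on $C^\infty(M)$ is an operator $D$ for which there is $k\in\mathbb{N}$ such that in every chart $D f=\sum_{|I|\le k} a_I\,\partial_I f$ with coefficients $a_I$ smooth on the chart domain; a bidifferential operator is a map $B$ on pairs of functions for which there is $k$ such that in every chart $B(f,g)=\sum_{|I|,|J|\le k} a_{I,J}\,\partial_I f\,\partial_J g$ with smooth coefficients. A star product on $M$ is an associative $\mathbb{R}[[\hbar]]$-bilinear product $\star$ on $C^\infty(M)[[\hbar]]$ such that $f\star g=\sum_{i\ge 0}B_i(f,g)\hbar^i$ for $f,g\in C^\infty(M)$, where the $B_i$ are bidifferential operators and $B_0(f,g)=fg$ (the constant $1$ is not required to be a unit for $\star$). Write $B_1^+(f,g)=\tfrac12\bigl(B_1(f,g)+B_1(g,f)\bigr)$. A gauge transformation is an $\mathbb{R}[[\hbar]]$-module automorphism $T$ of $C^\infty(M)[[\hbar]]$ with $T(f)=f+\sum_{i\ge1}T_i(f)\hbar^i$ for $f\in C^\infty(M)$, where the $T_i$ are linear differential operators. Star products $\star$ and $\star'$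 are gauge equivalent through $T$ if $T(u\star v)=T(u)\star' T(v)$ for all $u,v\in C^\infty(M)[[\hbar]]$. Proposition. (i) Every star product on $M$ is gauge equivalent, through some gauge transformation, to a star product whose first-order operator has vanishing symmetric part, $B_1^+=0$. (ii) If moreover the given star product satisfies $B_1(1,1)=0$ (for instance, if the constant function $1$ is a unit for it), then such an equivalence exists through a gauge transformation all of whose operators $T_i$, $i\ge1$, vanish on constant functions. -/

import Mathlib

open scoped Manifold ContDiff PowerSeries

noncomputable section

namespace StarProd

/-- The algebra `C^∞(M)` of smooth real functions on an `n`-dimensional manifold `M`, with the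
pointwise operations. -/
abbrev Fn (n : ℕ) (M : Type*) [TopologicalSpace M] [ChartedSpace (EuclideanSpace ℝ (Fin n)) M] :
    Type _ :=
  C^∞⟮𝓡 n, M; ℝ⟯

/-- The iterated coordinate derivative `∂_{w 0} ∂_{w 1} ⋯ ∂_{w (j-1)} f` at the point `x`, in the
local coordinates given by the chart `φ`. -/
def chartDeriv {n : ℕ} {M : Type*} [TopologicalSpace M]
    (φ : OpenPartialHomeomorph M (EuclideanSpace ℝ (Fin n))) {j : ℕ} (w : Fin j → Fin n)
    (f : M → ℝ) (x : M) : ℝ :=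
  iteratedFDeriv ℝ j (f ∘ φ.symm) (φ x) (fun i => EuclideanSpace.single (w i) (1 : ℝ))

/-- Words of length at most `k` in the coordinate indices. They index the coordinate derivatives
of order at most `k`; as partial derivatives of smooth functions commute, each multi-index `I` with
`|I| ≤ k` is represented, possibly by several words. -/
abbrev Word (n k : ℕ) : Type := Σ j : Fin (k + 1), (Fin (j : ℕ) → Fin n)

variable {n : ℕ} {M : Type*} [TopologicalSpace M] [ChartedSpace (EuclideanSpace ℝ (Fin n)) M]

/-- `D` is a linear differential operator of finite order: there is a `k` such that in every chart
of the smooth structure `D f = ∑_I a_I ∂_I f`, the sum being over `|I| ≤ k`, with coefficients `a_I`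
smooth on the domain of the chart. -/
def IsDiffOp [IsManifold (𝓡 n) ∞ M] (D : Fn n M → Fn n M) : Prop :=
  ∃ k : ℕ, ∀ φ ∈ IsManifold.maximalAtlas (𝓡 n) ∞ M,
    ∃ a : Word n k → M → ℝ,
      (∀ w, ContMDiffOn (𝓡 n) 𝓘(ℝ, ℝ) ∞ (a w) φ.source) ∧
      ∀ (f : Fn n M), ∀ x ∈ φ.source, D f x = ∑ w, a w x * chartDeriv φ w.2 f x

/-- `B` is a bidifferential operator of finite order: there is a `k` such that in every chart of the
smooth structure `B(f, g) = ∑_{I, J} a_{I, J} ∂_I f ∂_J g`, the sum being over `|I|, |J| ≤ k`, with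
coefficients smooth on the domain of the chart. -/
def IsBidiffOp [IsManifold (𝓡 n) ∞ M] (B : Fn n M → Fn n M → Fn n M) : Prop :=
  ∃ k : ℕ, ∀ φ ∈ IsManifold.maximalAtlas (𝓡 n) ∞ M,
    ∃ a : Word n k → Word n k → M → ℝ,
      (∀ v w, ContMDiffOn (𝓡 n) 𝓘(ℝ, ℝ) ∞ (a v w) φ.source) ∧
      ∀ (f g : Fn n M), ∀ x ∈ φ.source,
        B f g x = ∑ v, ∑ w, a v w x * chartDeriv φ v.2 f x * chartDeriv φ w.2 g x

variable (n M) in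
/-- A star product: an associative `ℝ⟦ħ⟧`-bilinear product on `C^∞(M)⟦ħ⟧` such that, for
`f, g ∈ C^∞(M)`, `f ⋆ g = ∑ B_i(f, g) ħ^i` with `B_i` bidifferential operators and
`B_0(f, g) = f g`. (An `ℝ⟦ħ⟧`-bilinear map on `C^∞(M)⟦ħ⟧` commutes with multiplication by `ħ`, so it
is determined by its values on `C^∞(M)`.) No unit is required. -/
structure StarProduct [IsManifold (𝓡 n) ∞ M] where
  /-- the product -/
  mul : (Fn n M)⟦X⟧ →ₗ[ℝ⟦X⟧] (Fn n M)⟦X⟧ →ₗ[ℝ⟦X⟧] (Fn n M)⟦X⟧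
  mul_assoc : ∀ u v w, mul (mul u v) w = mul u (mul v w)
  bidiff : ∀ i : ℕ,
    IsBidiffOp (fun f g : Fn n M => PowerSeries.coeff i (mul (PowerSeries.C f) (PowerSeries.C g)))
  zeroth : ∀ f g : Fn n M,
    PowerSeries.coeff 0 (mul (PowerSeries.C f) (PowerSeries.C g)) = f * g

namespace StarProduct

/-- The operator `B_i` of the star product. -/
def B [IsManifold (𝓡 n) ∞ M] (S : StarProduct n M) (i : ℕ) (f g : Fn n M) : Fn n M :=
  PowerSeries.coeff i (S.mul (PowerSeries.C f) (PowerSeries.C g))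

/-- The symmetric part `B_1^+(f, g) = (B_1(f, g) + B_1(g, f)) / 2`. -/
def B1plus [IsManifold (𝓡 n) ∞ M] (S : StarProduct n M) (f g : Fn n M) : Fn n M :=
  (1 / 2 : ℝ) • (S.B 1 f g + S.B 1 g f)

end StarProduct

/-- The operator `T_i` in `T(f) = ∑ T_i(f) ħ^i`, `f ∈ C^∞(M)`. -/
def component (T : (Fn n M)⟦X⟧ ≃ₗ[ℝ⟦X⟧] (Fn n M)⟦X⟧) (i : ℕ) (f : Fn n M) : Fn n M :=
  PowerSeries.coeff i (T (PowerSeries.C f))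

/-- `T` is an `ℝ⟦ħ⟧`-module automorphism of `C^∞(M)⟦ħ⟧` with `T(f) = f + ∑_{i ≥ 1} T_i(f) ħ^i` for
`f ∈ C^∞(M)`, where the `T_i` are linear differential operators. -/
def IsGauge [IsManifold (𝓡 n) ∞ M] (T : (Fn n M)⟦X⟧ ≃ₗ[ℝ⟦X⟧] (Fn n M)⟦X⟧) : Prop :=
  (∀ f, component T 0 f = f) ∧ ∀ i, IsDiffOp (component T i)

/-- The operators `T_i`, `i ≥ 1`, vanish on the constant functions. -/
def VanishesOnConstants (T : (Fn n M)⟦X⟧ ≃ₗ[ℝ⟦X⟧] (Fn n M)⟦X⟧) : Prop :=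
  ∀ i, 1 ≤ i → ∀ c : ℝ, component T i (algebraMap ℝ (Fn n M) c) = 0

/-- `T (u ⋆ v) = T u ⋆' T v` for all formal power series `u`, `v`. -/
def Intertwines [IsManifold (𝓡 n) ∞ M] (T : (Fn n M)⟦X⟧ ≃ₗ[ℝ⟦X⟧] (Fn n M)⟦X⟧)
    (S S' : StarProduct n M) : Prop :=
  ∀ u v, T (S.mul u v) = S'.mul (T u) (T v)

/-- Gauge equivalence of star products, the operators `T_i` being allowed to be nonzero on
constants. -/
def GaugeEquivalent [IsManifold (𝓡 n) ∞ M] (S S' : StarProduct n M) : Prop :=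
  ∃ T, IsGauge T ∧ Intertwines T S S'

/-- Gauge equivalence of star products by a gauge transformation whose operators `T_i`, `i ≥ 1`,
vanish on constants. -/
def StrictlyGaugeEquivalent [IsManifold (𝓡 n) ∞ M] (S S' : StarProduct n M) : Prop :=
  ∃ T, IsGauge T ∧ VanishesOnConstants T ∧ Intertwines T S S'

end StarProd

end

/-! At order ħ, associativity says that `B_1` is a Hochschild cocycle on the commutative algebra
C^∞(M), hence so is its symmetric part. Transport along id + ħD replaces `B_1` by `B_1` − δD, where
δD(f, g) = f·Dg + Df·g − D(fg) is symmetric. It therefore suffices to write `B_1^+` as δD with D a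
differential operator (`exists_isDiffOp_coboundary`).

In a chart, testing a bidifferential operator at x on exponentials of frequencies ξ, η centred at x
gives its symbol b(ξ, η), a polynomial. Exponentials multiply by adding frequencies and equal 1 at
x, so the Hochschild identity becomes b(ξ+η, ζ) + b(ξ, η) = b(ξ, η+ζ) + b(η, ζ). If L(ξ, v) is the
part of b linear in the second variable, then t(ξ) = b(0,0) − ∫₀¹ L(sξ, ξ) ds satisfies b(ξ, η) =
t(ξ) + t(η) − t(ξ+η) (`bisymbol_eq_coboundary`). The operator with symbol t is a local primitive,
since operators are determined by their action on exponentials (`eq_coboundary_primitive`). Because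
δ is linear over C^∞(M), a partition of unity glues the local primitives.

For (ii), evaluating `B_1^+` = δD at (1, 1) gives D1 = `B_1(1, 1)`, so D kills constants when this
vanishes. -/

open scoped Manifold ContDiff PowerSeries

noncomputable section

namespace StarProd

variable {n : ℕ} {M : Type*} [TopologicalSpace M]

/-- The coordinate derivative `∂_i h` in the chart `φ`. -/
def pd (φ : OpenPartialHomeomorph M (EuclideanSpace ℝ (Fin n))) (i : Fin n) (h : M → ℝ) (x : M) :
    ℝ :=
  fderiv ℝ (h ∘ φ.symm) (φ x) (EuclideanSpace.single i 1)

/-! ### Calculus of partial derivatives in a chart -/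

section Chart

variable {φ : OpenPartialHomeomorph M (EuclideanSpace ℝ (Fin n))}
  {x : M} {h g : M → ℝ}

theorem comp_symm_eventuallyEq (hx : x ∈ φ.source) (hgh : h =ᶠ[nhds x] g) :
    h ∘ φ.symm =ᶠ[nhds (φ x)] g ∘ φ.symm := by
  have : Filter.Tendsto φ.symm (nhds (φ x)) (nhds x) := by
    have := φ.continuousAt_symm (φ.map_source hx)
    rwa [ContinuousAt, φ.left_inv hx] at this
  exact this.eventually hgh

theorem pd_congr (hx : x ∈ φ.source) (hgh : h =ᶠ[nhds x] g) (i : Fin n) :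
    pd φ i h x = pd φ i g x := by
  simp only [pd, (comp_symm_eventuallyEq hx hgh).fderiv_eq]

theorem chartDeriv_congr (hx : x ∈ φ.source) (hgh : h =ᶠ[nhds x] g) {j : ℕ} (w : Fin j → Fin n) :
    chartDeriv φ w h x = chartDeriv φ w g x := by
  simp only [chartDeriv, ((comp_symm_eventuallyEq hx hgh).iteratedFDeriv ℝ j).eq_of_nhds]

theorem chartDeriv_zero (hx : x ∈ φ.source) (w : Fin 0 → Fin n) :
    chartDeriv φ w h x = h x := by
  simp [chartDeriv, φ.left_inv hx]

variable [ChartedSpace (EuclideanSpace ℝ (Fin n)) M]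

theorem contDiffAt_comp_symm (hφ : φ ∈ IsManifold.maximalAtlas (𝓡 n) ∞ M) (hx : x ∈ φ.source)
    (hh : ContMDiffAt (𝓡 n) 𝓘(ℝ, ℝ) ∞ h x) : ContDiffAt ℝ ∞ (h ∘ φ.symm) (φ x) := by
  rw [← contMDiffAt_iff_contDiffAt]
  refine ContMDiffAt.comp (φ x) (g := h) (I' := 𝓡 n) ?_
    (contMDiffAt_symm_of_mem_maximalAtlas hφ (φ.map_source hx))
  rwa [φ.left_inv hx]

theorem contMDiffAt_comp_chart (hφ : φ ∈ IsManifold.maximalAtlas (𝓡 n) ∞ M) (hx : x ∈ φ.source)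
    {F : EuclideanSpace ℝ (Fin n) → ℝ} (hF : ContDiffAt ℝ ∞ F (φ x)) :
    ContMDiffAt (𝓡 n) 𝓘(ℝ, ℝ) ∞ (fun y => F (φ y)) x :=
  ContMDiffAt.comp x (g := F) (I' := 𝓡 n) hF.contMDiffAt
    (contMDiffAt_of_mem_maximalAtlas hφ hx)

theorem contMDiffAt_pd (hφ : φ ∈ IsManifold.maximalAtlas (𝓡 n) ∞ M) (hx : x ∈ φ.source)
    (hh : ContMDiffAt (𝓡 n) 𝓘(ℝ, ℝ) ∞ h x) (i : Fin n) :
    ContMDiffAt (𝓡 n) 𝓘(ℝ, ℝ) ∞ (pd φ i h) x := by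
  have h1 : ContDiffAt ℝ ∞ (fderiv ℝ (h ∘ φ.symm)) (φ x) :=
    (contDiffAt_comp_symm hφ hx hh).fderiv_right (by simp)
  exact contMDiffAt_comp_chart hφ hx
    (F := fun y => fderiv ℝ (h ∘ φ.symm) y (EuclideanSpace.single i 1))
    (h1.clm_apply contDiffAt_const)

theorem differentiableAt_comp_symm (hφ : φ ∈ IsManifold.maximalAtlas (𝓡 n) ∞ M)
    (hx : x ∈ φ.source) (hh : ContMDiffAt (𝓡 n) 𝓘(ℝ, ℝ) ∞ h x) :
    DifferentiableAt ℝ (h ∘ φ.symm) (φ x) :=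
  (contDiffAt_comp_symm hφ hx hh).differentiableAt (by simp)

theorem pd_mul (hφ : φ ∈ IsManifold.maximalAtlas (𝓡 n) ∞ M) (hx : x ∈ φ.source)
    (hh : ContMDiffAt (𝓡 n) 𝓘(ℝ, ℝ) ∞ h x) (hg : ContMDiffAt (𝓡 n) 𝓘(ℝ, ℝ) ∞ g x) (i : Fin n) :
    pd φ i (fun y => h y * g y) x = pd φ i h x * g x + h x * pd φ i g x := by
  have h1 := differentiableAt_comp_symm hφ hx hh
  have h2 := differentiableAt_comp_symm hφ hx hg
  have h3 : (fun y => h y * g y) ∘ φ.symm = (h ∘ φ.symm) * (g ∘ φ.symm) := rfl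
  simp only [pd, h3, fderiv_mul h1 h2]
  simp [φ.left_inv hx]
  ring

theorem pd_sum (hφ : φ ∈ IsManifold.maximalAtlas (𝓡 n) ∞ M) (hx : x ∈ φ.source)
    {ι : Type*} (s : Finset ι) {F : ι → M → ℝ}
    (hF : ∀ k ∈ s, ContMDiffAt (𝓡 n) 𝓘(ℝ, ℝ) ∞ (F k) x) (i : Fin n) :
    pd φ i (fun y => ∑ k ∈ s, F k y) x = ∑ k ∈ s, pd φ i (F k) x := by
  have h1 : ∀ k ∈ s, DifferentiableAt ℝ (F k ∘ φ.symm) (φ x) := fun k hk =>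
    differentiableAt_comp_symm hφ hx (hF k hk)
  have h3 : (fun y => ∑ k ∈ s, F k y) ∘ φ.symm = fun y => ∑ k ∈ s, (F k ∘ φ.symm) y := by
    ext y; simp
  simp only [pd, h3, fderiv_fun_sum h1]
  simp

/-- Differentiation commutes with evaluating a multilinear map on fixed vectors. Inductions on the
order of a derivative rest on this. -/
theorem chartDeriv_succ (hφ : φ ∈ IsManifold.maximalAtlas (𝓡 n) ∞ M) (hx : x ∈ φ.source)
    (hh : ContMDiffAt (𝓡 n) 𝓘(ℝ, ℝ) ∞ h x) {j : ℕ} (w : Fin (j + 1) → Fin n) :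
    chartDeriv φ w h x = pd φ (w 0) (chartDeriv φ (Fin.tail w) h) x := by
  have h0 := contDiffAt_comp_symm hφ hx hh
  have h1 : DifferentiableAt ℝ (iteratedFDeriv ℝ j (h ∘ φ.symm)) (φ x) :=
    (h0.iteratedFDeriv_right (m := 1) (i := j) (by exact_mod_cast le_top)).differentiableAt (by simp)
  have h2 : chartDeriv φ (Fin.tail w) h ∘ φ.symm =ᶠ[nhds (φ x)] fun y =>
      iteratedFDeriv ℝ j (h ∘ φ.symm) y
        (fun i => EuclideanSpace.single (Fin.tail w i) (1 : ℝ)) := by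
    filter_upwards [φ.open_target.mem_nhds (φ.map_source hx)] with y hy
    simp [chartDeriv, φ.right_inv hy]
  rw [pd, h2.fderiv_eq, chartDeriv, iteratedFDeriv_succ_apply_left]
  rw [fderiv_continuousMultilinear_apply_const_apply h1]
  rfl

theorem contMDiffAt_chartDeriv (hφ : φ ∈ IsManifold.maximalAtlas (𝓡 n) ∞ M) (hx : x ∈ φ.source)
    (hh : ∀ y ∈ φ.source, ContMDiffAt (𝓡 n) 𝓘(ℝ, ℝ) ∞ h y) {j : ℕ} (w : Fin j → Fin n) :
    ContMDiffAt (𝓡 n) 𝓘(ℝ, ℝ) ∞ (chartDeriv φ w h) x := by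
  induction j with
  | zero =>
    refine (hh x hx).congr_of_eventuallyEq ?_
    filter_upwards [φ.open_source.mem_nhds hx] with y hy using chartDeriv_zero hy w
  | succ j ih =>
    refine (contMDiffAt_pd hφ hx (ih (Fin.tail w)) (w 0)).congr_of_eventuallyEq ?_
    filter_upwards [φ.open_source.mem_nhds hx] with y hy using chartDeriv_succ hφ hy (hh y hy) w

theorem pd_comm (hφ : φ ∈ IsManifold.maximalAtlas (𝓡 n) ∞ M) (hx : x ∈ φ.source)
    (hh : ContMDiffAt (𝓡 n) 𝓘(ℝ, ℝ) ∞ h x) (i j : Fin n) :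
    pd φ i (pd φ j h) x = pd φ j (pd φ i h) x := by
  have h0 := contDiffAt_comp_symm hφ hx hh
  have h1 : DifferentiableAt ℝ (fderiv ℝ (h ∘ φ.symm)) (φ x) :=
    (h0.fderiv_right (m := ∞) (by simp)).differentiableAt (by simp)
  have key (i j : Fin n) : pd φ i (pd φ j h) x = fderiv ℝ (fderiv ℝ (h ∘ φ.symm)) (φ x)
      (EuclideanSpace.single i 1) (EuclideanSpace.single j 1) := by
    have h2 : pd φ j h ∘ φ.symm =ᶠ[nhds (φ x)] fun y =>
        fderiv ℝ (h ∘ φ.symm) y (EuclideanSpace.single j 1) := by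
      filter_upwards [φ.open_target.mem_nhds (φ.map_source hx)] with y hy
      simp [pd, φ.right_inv hy]
    rw [pd, h2.fderiv_eq, fderiv_clm_apply h1 (differentiableAt_const _)]
    simp
  rw [key, key]
  exact h0.isSymmSndFDerivAt (by simpa using (WithTop.coe_le_coe.2 le_top : ((2 : ℕ∞) : WithTop ℕ∞) ≤ ∞)) _ _

/-- The chain rule for coordinate derivatives in two charts. -/
theorem pd_change_chart {ψ : OpenPartialHomeomorph M (EuclideanSpace ℝ (Fin n))}
    (hφ : φ ∈ IsManifold.maximalAtlas (𝓡 n) ∞ M) (hψ : ψ ∈ IsManifold.maximalAtlas (𝓡 n) ∞ M)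
    (hx : x ∈ φ.source) (hx' : x ∈ ψ.source) (hh : ContMDiffAt (𝓡 n) 𝓘(ℝ, ℝ) ∞ h x) (j : Fin n) :
    pd ψ j h x = ∑ i, pd ψ j (fun y => φ y i) x * pd φ i h x := by
  have hd := differentiableAt_comp_symm hφ hx hh
  have hφd : DifferentiableAt ℝ (φ ∘ ψ.symm) (ψ x) := by
    have : ContMDiffAt (𝓡 n) (𝓡 n) ∞ (φ ∘ ψ.symm) (ψ x) := by
      refine ContMDiffAt.comp (ψ x) (g := φ) (I' := 𝓡 n) ?_
        (contMDiffAt_symm_of_mem_maximalAtlas hψ (ψ.map_source hx'))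
      rw [ψ.left_inv hx']
      exact contMDiffAt_of_mem_maximalAtlas hφ hx
    exact (contMDiffAt_iff_contDiffAt.1 this).differentiableAt (by simp)
  have he : h ∘ ψ.symm =ᶠ[nhds (ψ x)] (h ∘ φ.symm) ∘ (φ ∘ ψ.symm) := by
    have : h =ᶠ[nhds x] h ∘ φ.symm ∘ φ := by
      filter_upwards [φ.open_source.mem_nhds hx] with y hy
      simp [φ.left_inv hy]
    exact comp_symm_eventuallyEq hx' this
  have hxx : (φ ∘ ψ.symm) (ψ x) = φ x := by simp [ψ.left_inv hx']
  have hc : ∀ i, pd ψ j (fun y => φ y i) x =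
      (fderiv ℝ (φ ∘ ψ.symm) (ψ x) (EuclideanSpace.single j 1)) i := by
    intro i
    have h4 : (fun y => φ y i) ∘ ψ.symm = (EuclideanSpace.proj (𝕜 := ℝ) i) ∘ (φ ∘ ψ.symm) := rfl
    rw [pd, h4, fderiv_comp _ (ContinuousLinearMap.differentiableAt _) hφd,
      ContinuousLinearMap.fderiv]
    rfl
  simp only [hc]
  rw [pd, he.fderiv_eq, fderiv_comp _ (by rwa [hxx]) hφd, hxx, ContinuousLinearMap.comp_apply]
  set v := fderiv ℝ (φ ∘ ψ.symm) (ψ x) (EuclideanSpace.single j 1)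
  have hv : v = ∑ i, v i • EuclideanSpace.single i (1 : ℝ) := by
    ext k
    simp [Finset.sum_apply, Pi.single_apply]
  conv_lhs => rw [hv, map_sum]
  simp [pd]

end Chart

/-! ### Linear combinations with smooth coefficients -/

section Comb

variable [ChartedSpace (EuclideanSpace ℝ (Fin n)) M] {ι κ X : Type*} [Fintype ι] [Fintype κ]
  {U : Set M} {v : ι → X → M → ℝ} {v' : κ → X → M → ℝ} {F G : X → M → ℝ}

/-- On `U`, the map `F` is a linear combination of the maps `v i` with smooth coefficients. -/
def IsComb (U : Set M) (v : ι → X → M → ℝ) (F : X → M → ℝ) : Prop :=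
  ∃ a : ι → M → ℝ, (∀ i, ∀ x ∈ U, ContMDiffAt (𝓡 n) 𝓘(ℝ, ℝ) ∞ (a i) x) ∧
    ∀ f, ∀ x ∈ U, F f x = ∑ i, a i x * v i f x

namespace IsComb

theorem congr (hF : IsComb (n := n) U v F) (h : ∀ f, ∀ x ∈ U, G f x = F f x) :
    IsComb (n := n) U v G := by
  obtain ⟨a, ha, h'⟩ := hF
  exact ⟨a, ha, fun f x hx => (h f x hx).trans (h' f x hx)⟩

theorem zero : IsComb (n := n) U v (fun _ _ => 0) :=
  ⟨fun _ _ => 0, fun _ _ _ => contMDiffAt_const, by simp⟩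

theorem add (hF : IsComb (n := n) U v F) (hG : IsComb (n := n) U v G) :
    IsComb (n := n) U v (fun f x => F f x + G f x) := by
  obtain ⟨a, ha, h⟩ := hF
  obtain ⟨b, hb, h'⟩ := hG
  refine ⟨fun i x => a i x + b i x, fun i x hx => (ha i x hx).add (hb i x hx), fun f x hx => ?_⟩
  simp only [h f x hx, h' f x hx, add_mul, Finset.sum_add_distrib]

theorem mul_left {c : M → ℝ} (hc : ∀ x ∈ U, ContMDiffAt (𝓡 n) 𝓘(ℝ, ℝ) ∞ c x)
    (hF : IsComb (n := n) U v F) : IsComb (n := n) U v (fun f x => c x * F f x) := by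
  obtain ⟨a, ha, h⟩ := hF
  refine ⟨fun i x => c x * a i x, fun i x hx => (hc x hx).mul (ha i x hx), fun f x hx => ?_⟩
  simp only [h f x hx, mul_assoc, Finset.mul_sum]

theorem sum {α : Type*} (s : Finset α) {F : α → X → M → ℝ}
    (h : ∀ k ∈ s, IsComb (n := n) U v (F k)) :
    IsComb (n := n) U v (fun f x => ∑ k ∈ s, F k f x) := by
  classical
  induction s using Finset.induction_on with
  | empty => simpa using zero
  | insert k s hk ih =>
    simp only [Finset.sum_insert hk]
    exact (h k (by simp)).add (ih fun j hj => h j (by simp [hj]))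

theorem basis (i : ι) : IsComb (n := n) U v (v i) := by
  classical
  refine ⟨fun j _ => if j = i then 1 else 0, fun j x _ => contMDiffAt_const, fun f x _ => ?_⟩
  simp

theorem trans (hF : IsComb (n := n) U v F) (hv : ∀ i, IsComb (n := n) U v' (v i)) :
    IsComb (n := n) U v' F := by
  obtain ⟨a, ha, h⟩ := hF
  exact (sum Finset.univ fun i _ => (hv i).mul_left (ha i)).congr h

theorem mono {V : Set M} (hVU : V ⊆ U) (hF : IsComb (n := n) U v F) : IsComb (n := n) V v F := by
  obtain ⟨a, ha, h⟩ := hF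
  exact ⟨a, fun i x hx => ha i x (hVU hx), fun f x hx => h f x (hVU hx)⟩

/-- Precomposition with a map of the arguments. -/
theorem precomp {Y : Type*} (hF : IsComb (n := n) U v F) (p : Y → X) :
    IsComb (n := n) U (fun i f => v i (p f)) (fun f => F (p f)) := by
  obtain ⟨a, ha, h⟩ := hF
  exact ⟨a, ha, fun f x hx => h (p f) x hx⟩

/-- The product of combinations is a combination of the products. -/
theorem mul (hF : IsComb (n := n) U v F) (hG : IsComb (n := n) U v' G) :
    IsComb (n := n) U (fun (p : ι × κ) f x => v p.1 f x * v' p.2 f x)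
      (fun f x => F f x * G f x) := by
  obtain ⟨a, ha, h⟩ := hF
  obtain ⟨b, hb, h'⟩ := hG
  refine ⟨fun p x => a p.1 x * b p.2 x, fun p x hx => (ha p.1 x hx).mul (hb p.2 x hx),
    fun f x hx => ?_⟩
  simp only [h f x hx, h' f x hx, Finset.sum_mul_sum, Fintype.sum_prod_type]
  exact Finset.sum_congr rfl fun i _ => Finset.sum_congr rfl fun j _ => by ring

/-- The Leibniz rule produces ∂a·v + a·∂v, so `v'` has to span both the `v i` and their derivatives.
Openness of `U` makes the expansion of `F f` valid near the point. -/
theorem pd {φ : OpenPartialHomeomorph M (EuclideanSpace ℝ (Fin n))}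
    (hφ : φ ∈ IsManifold.maximalAtlas (𝓡 n) ∞ M) (hU : IsOpen U) (hUφ : U ⊆ φ.source)
    (hv : ∀ i f, ∀ x ∈ U, ContMDiffAt (𝓡 n) 𝓘(ℝ, ℝ) ∞ (v i f) x)
    (j : Fin n) (hv1 : ∀ i, IsComb (n := n) U v' (v i))
    (hv2 : ∀ i, IsComb (n := n) U v' (fun f => StarProd.pd φ j (v i f)))
    (hF : IsComb (n := n) U v F) : IsComb (n := n) U v' (fun f => StarProd.pd φ j (F f)) := by
  obtain ⟨a, ha, h⟩ := hF
  have h1 : ∀ i, IsComb (n := n) U v'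
      (fun f x => StarProd.pd φ j (a i) x * v i f x + a i x * StarProd.pd φ j (v i f) x) := fun i =>
    ((hv1 i).mul_left fun x hx => contMDiffAt_pd hφ (hUφ hx) (ha i x hx) j).add
      ((hv2 i).mul_left (ha i))
  refine (sum Finset.univ fun i _ => h1 i).congr fun f x hx => ?_
  have h2 : F f =ᶠ[nhds x] fun y => ∑ i, a i y * v i f y := by
    filter_upwards [hU.mem_nhds hx] with y hy using h f y hy
  rw [pd_congr (hUφ hx) h2, pd_sum (F := fun i y => a i y * v i f y) hφ (hUφ hx) _
    fun i _ => (ha i x hx).mul (hv i f x hx)]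
  exact Finset.sum_congr rfl fun i _ => pd_mul hφ (hUφ hx) (ha i x hx) (hv i f x hx) j

end IsComb

end Comb

/-! ### Combinations of derivatives of bounded order -/

section Jets

variable [ChartedSpace (EuclideanSpace ℝ (Fin n)) M] {X Y : Type*} {U : Set M}
  {φ ψ : OpenPartialHomeomorph M (EuclideanSpace ℝ (Fin n))} {k l m : ℕ}

/-- The coordinate derivatives of order at most `k`. -/
def jet (φ : OpenPartialHomeomorph M (EuclideanSpace ℝ (Fin n))) (k : ℕ) (w : Word n k)
    (f : Fn n M) (x : M) : ℝ :=
  chartDeriv φ w.2 f x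

/-- The products of coordinate derivatives of order at most `k`. -/
def bijet (φ : OpenPartialHomeomorph M (EuclideanSpace ℝ (Fin n))) (k : ℕ)
    (p : Word n k × Word n k) (f : Fn n M × Fn n M) (x : M) : ℝ :=
  jet φ k p.1 f.1 x * jet φ k p.2 f.2 x

theorem contMDiffAt_jet (hφ : φ ∈ IsManifold.maximalAtlas (𝓡 n) ∞ M) (w : Word n k) (f : Fn n M)
    {x : M} (hx : x ∈ φ.source) : ContMDiffAt (𝓡 n) 𝓘(ℝ, ℝ) ∞ (jet φ k w f) x :=
  contMDiffAt_chartDeriv hφ hx (fun y _ => f.contMDiff y) w.2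

theorem isComb_chartDeriv {j : ℕ} (hj : j ≤ k) (w : Fin j → Fin n) :
    IsComb (n := n) U (jet φ k) (fun f : Fn n M => chartDeriv φ w f) :=
  IsComb.basis (v := jet φ k) ⟨⟨j, Nat.lt_succ_of_le hj⟩, w⟩

theorem isComb_jet_of_le (hkl : k ≤ l) (w : Word n k) :
    IsComb (n := n) U (jet φ l) (jet φ k w) :=
  isComb_chartDeriv ((Nat.le_of_lt_succ w.1.2).trans hkl) w.2

theorem isComb_pd_jet (hφ : φ ∈ IsManifold.maximalAtlas (𝓡 n) ∞ M) (hUφ : U ⊆ φ.source)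
    (j : Fin n) (w : Word n k) :
    IsComb (n := n) U (jet φ (k + 1)) (fun f => pd φ j (jet φ k w f)) := by
  refine (isComb_chartDeriv (Nat.succ_le_succ (Nat.le_of_lt_succ w.1.2))
    (Fin.cons j w.2 : Fin (w.1 + 1) → Fin n)).congr fun f x hx => ?_
  rw [chartDeriv_succ hφ (hUφ hx) (f.contMDiff x)]
  simp only [Fin.cons_zero, Fin.tail_cons]
  rfl

theorem IsComb.pd_of_jet (hφ : φ ∈ IsManifold.maximalAtlas (𝓡 n) ∞ M) (hU : IsOpen U)
    (hUφ : U ⊆ φ.source) (j : Fin n) {F : Fn n M → M → ℝ} (hF : IsComb (n := n) U (jet φ k) F) :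
    IsComb (n := n) U (jet φ (k + 1)) (fun f => StarProd.pd φ j (F f)) :=
  hF.pd hφ hU hUφ (fun i f _ hx => contMDiffAt_jet hφ i f (hUφ hx)) j
    (isComb_jet_of_le (Nat.le_succ k)) (isComb_pd_jet hφ hUφ j)

theorem isComb_bijet_of_le (hkl : k ≤ l) (p : Word n k × Word n k) :
    IsComb (n := n) U (bijet φ l) (bijet φ k p) :=
  ((isComb_jet_of_le hkl p.1).precomp Prod.fst).mul ((isComb_jet_of_le hkl p.2).precomp Prod.snd)

theorem IsComb.pd_of_bijet (hφ : φ ∈ IsManifold.maximalAtlas (𝓡 n) ∞ M) (hU : IsOpen U)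
    (hUφ : U ⊆ φ.source) (j : Fin n) {F : Fn n M × Fn n M → M → ℝ}
    (hF : IsComb (n := n) U (bijet φ k) F) :
    IsComb (n := n) U (bijet φ (k + 1)) (fun f => StarProd.pd φ j (F f)) := by
  refine hF.pd hφ hU hUφ (fun i f _ hx => (contMDiffAt_jet hφ i.1 f.1 (hUφ hx)).mul
    (contMDiffAt_jet hφ i.2 f.2 (hUφ hx))) j (isComb_bijet_of_le (Nat.le_succ k)) fun p => ?_
  have h1 := ((isComb_pd_jet hφ hUφ j p.1).precomp (Prod.fst (β := Fn n M))).mul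
    ((isComb_jet_of_le (φ := φ) (Nat.le_succ k) p.2).precomp (Prod.snd (α := Fn n M)))
  have h2 := ((isComb_jet_of_le (φ := φ) (Nat.le_succ k) p.1).precomp (Prod.fst (β := Fn n M))).mul
    ((isComb_pd_jet hφ hUφ j p.2).precomp (Prod.snd (α := Fn n M)))
  exact (h1.add h2).congr fun f x hx => pd_mul hφ (hUφ hx) (contMDiffAt_jet hφ p.1 f.1 (hUφ hx))
    (contMDiffAt_jet hφ p.2 f.2 (hUφ hx)) j

/-- Coordinate derivatives of a family of combinations, provided one derivative of a combination
of order `k` is a combination of order `k + 1`. -/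
theorem IsComb.chartDeriv {ι : ℕ → Type*} [∀ k, Fintype (ι k)] {v : ∀ k, ι k → X → M → ℝ}
    (hφ : φ ∈ IsManifold.maximalAtlas (𝓡 n) ∞ M)
    (hv : ∀ k j (F : X → M → ℝ), IsComb (n := n) φ.source (v k) F →
      IsComb (n := n) φ.source (v (k + 1)) (fun f => StarProd.pd φ j (F f)))
    {F : X → Fn n M} (hF : IsComb (n := n) φ.source (v k) (fun f => F f))
    {m : ℕ} (w : Fin m → Fin n) :
    IsComb (n := n) φ.source (v (k + m)) (fun f => StarProd.chartDeriv φ w (F f)) := by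
  induction m with
  | zero => exact hF.congr fun f x hx => chartDeriv_zero hx w
  | succ m ih =>
    exact (hv _ (w 0) _ (ih (Fin.tail w))).congr fun f x hx =>
      chartDeriv_succ hφ hx ((F f).contMDiff x) w

theorem IsComb.chartDeriv_of_jet (hφ : φ ∈ IsManifold.maximalAtlas (𝓡 n) ∞ M)
    {F : Fn n M → Fn n M} (hF : IsComb (n := n) φ.source (jet φ k) (fun f => F f))
    (w : Word n l) : IsComb (n := n) φ.source (jet φ (k + l)) (fun f => jet φ l w (F f)) :=
  (IsComb.chartDeriv (v := jet φ) hφ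
    (fun _ j _ h => h.pd_of_jet hφ φ.open_source subset_rfl j) hF w.2).trans
    (isComb_jet_of_le (Nat.add_le_add_left (Nat.le_of_lt_succ w.1.2) k))

theorem IsComb.chartDeriv_of_bijet (hφ : φ ∈ IsManifold.maximalAtlas (𝓡 n) ∞ M)
    {F : Fn n M × Fn n M → Fn n M} (hF : IsComb (n := n) φ.source (bijet φ k) (fun f => F f))
    (w : Word n l) : IsComb (n := n) φ.source (bijet φ (k + l)) (fun f => jet φ l w (F f)) :=
  (IsComb.chartDeriv (v := bijet φ) hφ
    (fun _ j _ h => h.pd_of_bijet hφ φ.open_source subset_rfl j) hF w.2).trans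
    (isComb_bijet_of_le (Nat.add_le_add_left (Nat.le_of_lt_succ w.1.2) k))

/-- By the chain rule each derivative along `ψ` is a smooth combination of derivatives along `φ`, so
the order does not grow. This lets primitives built in different charts be read in a common one. -/
theorem isComb_jet_change_chart (hφ : φ ∈ IsManifold.maximalAtlas (𝓡 n) ∞ M)
    (hψ : ψ ∈ IsManifold.maximalAtlas (𝓡 n) ∞ M) (w : Word n k) :
    IsComb (n := n) (φ.source ∩ ψ.source) (jet φ k) (jet ψ k w) := by
  have key : ∀ (m : ℕ) (w : Fin m → Fin n), IsComb (n := n) (φ.source ∩ ψ.source) (jet φ m)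
      (fun f : Fn n M => chartDeriv ψ w f) := by
    intro m
    induction m with
    | zero =>
      intro w
      refine (isComb_chartDeriv (φ := φ) le_rfl w).congr fun f x hx => ?_
      rw [chartDeriv_zero hx.1, chartDeriv_zero hx.2]
    | succ m ih =>
      intro w
      have h1 := fun i : Fin n => ((ih (Fin.tail w)).pd_of_jet hφ
        (φ.open_source.inter ψ.open_source) Set.inter_subset_left i).mul_left
        (c := pd ψ (w 0) (fun y => φ y i)) fun x hx => contMDiffAt_pd hψ hx.2
          (contMDiffAt_comp_chart hφ hx.1 (F := fun z => z i)
            (EuclideanSpace.proj (𝕜 := ℝ) i).contDiff.contDiffAt) (w 0)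
      refine (IsComb.sum Finset.univ fun i _ => h1 i).congr fun f x hx => ?_
      rw [chartDeriv_succ hψ hx.2 (f.contMDiff x), pd_change_chart hφ hψ hx.1 hx.2
        (contMDiffAt_chartDeriv hψ hx.2 (fun y _ => f.contMDiff y) _)]
  exact (key _ w.2).trans (isComb_jet_of_le (Nat.le_of_lt_succ w.1.2))

end Jets

/-! ### Differential and bidifferential operators -/

section DiffOp

variable [ChartedSpace (EuclideanSpace ℝ (Fin n)) M] [IsManifold (𝓡 n) ∞ M]

theorem isDiffOp_iff {D : Fn n M → Fn n M} :
    IsDiffOp D ↔ ∃ k, ∀ φ ∈ IsManifold.maximalAtlas (𝓡 n) ∞ M,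
      IsComb (n := n) φ.source (jet φ k) (fun f => D f) := by
  refine exists_congr fun k => forall₂_congr fun φ hφ => exists_congr fun a => and_congr_left' ?_
  refine forall_congr' fun w => ⟨fun h x hx => h.contMDiffAt (φ.open_source.mem_nhds hx),
    fun h x hx => (h x hx).contMDiffWithinAt⟩

/-- A pair of functions is treated as a single argument, so that linear and bidifferential operators
share the same calculus of combinations. -/
theorem isBidiffOp_iff {B : Fn n M → Fn n M → Fn n M} :
    IsBidiffOp B ↔ ∃ k, ∀ φ ∈ IsManifold.maximalAtlas (𝓡 n) ∞ M,
      IsComb (n := n) φ.source (bijet φ k) (fun f => B f.1 f.2) := by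
  refine exists_congr fun k => forall₂_congr fun φ hφ => ⟨?_, ?_⟩
  · rintro ⟨a, ha, h⟩
    refine ⟨fun p => a p.1 p.2, fun p x hx => (ha p.1 p.2).contMDiffAt (φ.open_source.mem_nhds hx),
      fun f x hx => ?_⟩
    refine (h f.1 f.2 x hx).trans ?_
    rw [Fintype.sum_prod_type]
    simp only [bijet, jet, mul_assoc]
  · rintro ⟨a, ha, h⟩
    refine ⟨fun v w => a (v, w), fun v w x hx => (ha (v, w) x hx).contMDiffWithinAt,
      fun f g x hx => ?_⟩
    refine (h (f, g) x hx).trans ?_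
    rw [Fintype.sum_prod_type]
    simp only [bijet, jet, mul_assoc]

variable {D E : Fn n M → Fn n M} {B B' : Fn n M → Fn n M → Fn n M}

theorem isDiffOp_id : IsDiffOp (fun f : Fn n M => f) := by
  refine isDiffOp_iff.2 ⟨0, fun φ hφ => (isComb_chartDeriv le_rfl Fin.elim0).congr fun f x hx => ?_⟩
  rw [chartDeriv_zero hx]

theorem isDiffOp_zero : IsDiffOp (fun _ : Fn n M => 0) :=
  isDiffOp_iff.2 ⟨0, fun _ _ => IsComb.zero⟩

theorem IsDiffOp.comp (hD : IsDiffOp D) (hE : IsDiffOp E) : IsDiffOp (fun f => D (E f)) := by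
  obtain ⟨k, hk⟩ := isDiffOp_iff.1 hD
  obtain ⟨l, hl⟩ := isDiffOp_iff.1 hE
  refine isDiffOp_iff.2 ⟨l + k, fun φ hφ => ?_⟩
  exact ((hk φ hφ).precomp E).trans fun w => (hl φ hφ).chartDeriv_of_jet hφ w

theorem IsDiffOp.neg (hD : IsDiffOp D) : IsDiffOp (fun f => -D f) := by
  obtain ⟨k, hk⟩ := isDiffOp_iff.1 hD
  refine isDiffOp_iff.2 ⟨k, fun φ hφ => ((hk φ hφ).mul_left (c := fun _ => -1)
    fun x _ => contMDiffAt_const).congr fun f x _ => ?_⟩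
  simp

theorem IsDiffOp.comp_bidiffOp (hD : IsDiffOp D) (hB : IsBidiffOp B) :
    IsBidiffOp (fun f g => D (B f g)) := by
  obtain ⟨k, hk⟩ := isDiffOp_iff.1 hD
  obtain ⟨l, hl⟩ := isBidiffOp_iff.1 hB
  refine isBidiffOp_iff.2 ⟨l + k, fun φ hφ => ?_⟩
  exact ((hk φ hφ).precomp fun f : Fn n M × Fn n M => B f.1 f.2).trans fun w =>
    (hl φ hφ).chartDeriv_of_bijet (F := fun f => B f.1 f.2) hφ w

theorem IsBidiffOp.exists_order_le (hB : IsBidiffOp B) (l : ℕ) :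
    ∃ k, l ≤ k ∧ ∀ φ ∈ IsManifold.maximalAtlas (𝓡 n) ∞ M,
      IsComb (n := n) φ.source (bijet φ k) (fun f => B f.1 f.2) := by
  obtain ⟨k, hk⟩ := isBidiffOp_iff.1 hB
  exact ⟨max k l, le_max_right _ _, fun φ hφ =>
    (hk φ hφ).trans (isComb_bijet_of_le (le_max_left k l))⟩

theorem IsBidiffOp.comp (hB : IsBidiffOp B) (hD : IsDiffOp D) (hE : IsDiffOp E) :
    IsBidiffOp (fun f g => B (D f) (E g)) := by
  obtain ⟨k, hk⟩ := isBidiffOp_iff.1 hB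
  obtain ⟨l, hl⟩ := isDiffOp_iff.1 hD
  obtain ⟨m, hm⟩ := isDiffOp_iff.1 hE
  refine isBidiffOp_iff.2 ⟨max (l + k) (m + k), fun φ hφ => ?_⟩
  refine ((hk φ hφ).precomp fun f : Fn n M × Fn n M => (D f.1, E f.2)).trans fun p => ?_
  have h1 := ((hl φ hφ).chartDeriv_of_jet hφ p.1).trans
    (isComb_jet_of_le (le_max_left (l + k) (m + k)))
  have h2 := ((hm φ hφ).chartDeriv_of_jet hφ p.2).trans
    (isComb_jet_of_le (le_max_right (l + k) (m + k)))
  exact (h1.precomp Prod.fst).mul (h2.precomp Prod.snd)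

theorem isBidiffOp_zero : IsBidiffOp (fun _ _ : Fn n M => 0) :=
  isBidiffOp_iff.2 ⟨0, fun _ _ => IsComb.zero⟩

theorem IsBidiffOp.add (hB : IsBidiffOp B) (hB' : IsBidiffOp B') :
    IsBidiffOp (fun f g => B f g + B' f g) := by
  obtain ⟨k, hk⟩ := isBidiffOp_iff.1 hB
  obtain ⟨l, hkl, hl⟩ := hB'.exists_order_le k
  exact isBidiffOp_iff.2 ⟨l, fun φ hφ =>
    ((hk φ hφ).trans (isComb_bijet_of_le hkl)).add (hl φ hφ)⟩

theorem IsBidiffOp.sum {α : Type*} (s : Finset α) {B : α → Fn n M → Fn n M → Fn n M}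
    (h : ∀ k ∈ s, IsBidiffOp (B k)) : IsBidiffOp (fun f g => ∑ k ∈ s, B k f g) := by
  classical
  induction s using Finset.induction_on with
  | empty => simpa using isBidiffOp_zero
  | insert k s hk ih =>
    simp only [Finset.sum_insert hk]
    exact (h k (by simp)).add (ih fun j hj => h j (by simp [hj]))

/-- The symmetrization of a bidifferential operator. -/
theorem IsBidiffOp.symm (hB : IsBidiffOp B) :
    IsBidiffOp (fun f g => (1 / 2 : ℝ) • (B f g + B g f)) := by
  obtain ⟨k, hk⟩ := isBidiffOp_iff.1 hB
  refine isBidiffOp_iff.2 ⟨k, fun φ hφ => ?_⟩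
  have h1 : IsComb (n := n) φ.source (bijet φ k) (fun f : Fn n M × Fn n M => B f.2 f.1) :=
    ((hk φ hφ).precomp Prod.swap).trans fun p => (IsComb.basis p.swap).congr fun f x _ =>
      mul_comm _ _
  exact (((hk φ hφ).add h1).mul_left (c := fun _ => 1 / 2) fun x _ => contMDiffAt_const).congr
    fun f x _ => rfl

end DiffOp

/-! ### Symbols, and symmetric polynomial cocycles -/

section Symbols

/-- The monomial `∏_i ξ_{w i}`, the symbol of the coordinate derivative `∂_w`. -/
def wordMonomial (ξ : Fin n → ℝ) {j : ℕ} (w : Fin j → Fin n) : ℝ :=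
  ∏ i, ξ (w i)

theorem wordMonomial_smul (s : ℝ) (ξ : Fin n → ℝ) {j : ℕ} (w : Fin j → Fin n) :
    wordMonomial (s • ξ) w = s ^ j * wordMonomial ξ w := by
  simp [wordMonomial, Finset.prod_mul_distrib]

theorem wordMonomial_cons (ξ : Fin n → ℝ) {j : ℕ} (i : Fin n) (w : Fin j → Fin n) :
    wordMonomial ξ (Fin.cons i w : Fin (j + 1) → Fin n) = ξ i * wordMonomial ξ w := by
  simp [wordMonomial, Fin.prod_univ_succ]

theorem differentiable_wordMonomial {j : ℕ} (w : Fin j → Fin n) :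
    Differentiable ℝ fun ξ : Fin n → ℝ => wordMonomial ξ w := by
  unfold wordMonomial
  fun_prop

/-- The word of length zero. -/
def emptyWord (n k : ℕ) : Word n k := ⟨⟨0, Nat.succ_pos k⟩, Fin.elim0⟩

/-- The word of length one with the letter `j`. -/
def letter (k : ℕ) (j : Fin n) : Word n (k + 1) :=
  ⟨⟨1, Nat.succ_lt_succ (Nat.succ_pos k)⟩, fun _ => j⟩

theorem length_ne_zero {k : ℕ} {w : Word n k} (hw : w ≠ emptyWord n k) : (w.1 : ℕ) ≠ 0 := by
  obtain ⟨⟨j, hj⟩, w⟩ := w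
  rintro rfl
  exact hw (by rw [emptyWord, Subsingleton.elim w])

theorem sum_zero_pow_length {k : ℕ} (c : Word n k → ℝ) :
    ∑ w : Word n k, c w * 0 ^ (w.1 : ℕ) = c (emptyWord n k) := by
  rw [Finset.sum_eq_single (emptyWord n k)]
  · simp [emptyWord]
  · intro w _ hw
    rw [zero_pow (length_ne_zero hw), mul_zero]
  · simp

/-- The left side is the derivative at ε = 0 of ∑ c_w ε^|w|, to which only words of length one
contribute. For the empty word, truncated subtraction gives 0 ^ 0 = 1, but the factor |w| = 0
removes the term. -/
theorem sum_length_mul_zero_pow {k : ℕ} (c : Word n (k + 1) → ℝ) :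
    ∑ w : Word n (k + 1), c w * ((w.1 : ℕ) * 0 ^ ((w.1 : ℕ) - 1)) = ∑ j, c (letter k j) := by
  rw [Fintype.sum_sigma, Finset.sum_eq_single ⟨1, Nat.succ_lt_succ (Nat.succ_pos k)⟩]
  · refine Fintype.sum_equiv (Equiv.funUnique (Fin 1) (Fin n)) _ _ fun w => ?_
    have : w = fun _ => w 0 := funext fun i => by rw [Subsingleton.elim i 0]
    simp only [Nat.cast_one, Nat.sub_self, pow_zero, mul_one, letter]
    rw [this]
    rfl
  · intro j _ hj
    refine Finset.sum_eq_zero fun w _ => ?_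
    have h1 : (j : ℕ) ≠ 1 := fun h => hj (Fin.ext h)
    rcases Nat.eq_zero_or_pos (j : ℕ) with h0 | h0
    · simp [h0]
    · rw [zero_pow (by omega : (j : ℕ) - 1 ≠ 0)]
      simp
  · simp

variable {k : ℕ} (a : Word n (k + 1) × Word n (k + 1) → ℝ)

/-- The symbol of the bidifferential operator with constant coefficients `a`. -/
def bisymbol (ξ η : Fin n → ℝ) : ℝ :=
  ∑ p, a p * (wordMonomial ξ p.1.2 * wordMonomial η p.2.2)

/-- The part of the symbol which is linear in the second variable. -/
def linSymbol (ξ v : Fin n → ℝ) : ℝ :=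
  ∑ w, ∑ j, a (w, letter k j) * (wordMonomial ξ w.2 * v j)

/-- The symbol of the primitive of a symmetric cocycle. -/
def primSymbol (ξ : Fin n → ℝ) : ℝ :=
  a (emptyWord n _, emptyWord n _) -
    ∑ w, ∑ j, a (w, letter k j) / ((w.1 : ℕ) + 1) * (ξ j * wordMonomial ξ w.2)

theorem differentiable_bisymbol :
    Differentiable ℝ fun p : (Fin n → ℝ) × (Fin n → ℝ) => bisymbol a p.1 p.2 := by
  unfold bisymbol
  refine Differentiable.fun_sum fun p _ => Differentiable.const_mul (Differentiable.mul ?_ ?_) _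
  · exact (differentiable_wordMonomial p.1.2).comp differentiable_fst
  · exact (differentiable_wordMonomial p.2.2).comp differentiable_snd

theorem hasDerivAt_bisymbol_smul (ξ v : Fin n → ℝ) :
    HasDerivAt (fun ε : ℝ => bisymbol a ξ (ε • v)) (linSymbol a ξ v) 0 := by
  have h1 : linSymbol a ξ v = ∑ p : Word n (k + 1) × Word n (k + 1),
      a p * wordMonomial ξ p.1.2 * wordMonomial v p.2.2 *
        ((p.2.1 : ℕ) * 0 ^ ((p.2.1 : ℕ) - 1)) := by
    rw [Fintype.sum_prod_type, linSymbol]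
    refine Finset.sum_congr rfl fun w _ => ?_
    rw [sum_length_mul_zero_pow fun u => a (w, u) * wordMonomial ξ w.2 * wordMonomial v u.2]
    refine Finset.sum_congr rfl fun j _ => ?_
    have h : wordMonomial v (letter k j).2 = v j := Fin.prod_univ_one _
    rw [h, mul_assoc]
  rw [h1]
  have h2 : (fun ε : ℝ => bisymbol a ξ (ε • v)) = fun ε =>
      ∑ p : Word n (k + 1) × Word n (k + 1),
        a p * wordMonomial ξ p.1.2 * wordMonomial v p.2.2 * ε ^ (p.2.1 : ℕ) := by
    ext ε
    refine Finset.sum_congr rfl fun p _ => ?_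
    rw [wordMonomial_smul]
    ring
  rw [h2]
  exact HasDerivAt.fun_sum fun p _ => (hasDerivAt_pow _ _).const_mul _

/-- `primSymbol a ξ` is b(0,0) − ∫₀¹ `linSymbol a (s • ξ) ξ` ds; the denominators |w| + 1 come from
integrating s^|w|. -/
theorem hasDerivAt_primSymbol_smul (ξ : Fin n → ℝ) (s : ℝ) :
    HasDerivAt (fun s : ℝ => primSymbol a (s • ξ)) (-linSymbol a (s • ξ) ξ) s := by
  have h2 : (fun s : ℝ => primSymbol a (s • ξ)) = fun s =>
      a (emptyWord n _, emptyWord n _) - ∑ w : Word n (k + 1), ∑ j,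
        a (w, letter k j) / ((w.1 : ℕ) + 1) * (ξ j * wordMonomial ξ w.2) *
          s ^ ((w.1 : ℕ) + 1) := by
    ext s
    refine congrArg _ (Finset.sum_congr rfl fun w _ => Finset.sum_congr rfl fun j _ => ?_)
    rw [wordMonomial_smul, Pi.smul_apply, smul_eq_mul]
    ring
  rw [h2, linSymbol]
  refine HasDerivAt.const_sub _ (HasDerivAt.fun_sum fun w _ => HasDerivAt.fun_sum fun j _ => ?_)
  refine ((hasDerivAt_pow _ _).const_mul _).congr_deriv ?_
  rw [wordMonomial_smul]
  have : ((w.1 : ℕ) : ℝ) + 1 ≠ 0 := by positivity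
  push_cast
  field_simp

/-- A symmetric polynomial cocycle is the coboundary of `primSymbol`. -/
theorem bisymbol_eq_coboundary (hsymm : ∀ ξ η, bisymbol a ξ η = bisymbol a η ξ)
    (hcoc : ∀ ξ η ζ, bisymbol a (ξ + η) ζ + bisymbol a ξ η =
      bisymbol a ξ (η + ζ) + bisymbol a η ζ) (ξ η : Fin n → ℝ) :
    bisymbol a ξ η = primSymbol a ξ + primSymbol a η - primSymbol a (ξ + η) := by
  have hfd : ∀ p q : Fin n → ℝ, HasFDerivAt (fun r : (Fin n → ℝ) × (Fin n → ℝ) =>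
      bisymbol a r.1 r.2) (fderiv ℝ (fun r : (Fin n → ℝ) × (Fin n → ℝ) =>
      bisymbol a r.1 r.2) (p, q)) (p, q) := fun p q =>
    (differentiable_bisymbol a _).hasFDerivAt
  set D := fderiv ℝ (fun r : (Fin n → ℝ) × (Fin n → ℝ) => bisymbol a r.1 r.2) with hD
  have hline : ∀ p q u v : Fin n → ℝ, ∀ s : ℝ, HasDerivAt
      (fun s : ℝ => bisymbol a (p + s • u) (q + s • v)) (D (p + s • u, q + s • v) (u, v)) s := by
    intro p q u v s
    have h1 : HasDerivAt (fun s : ℝ => (p + s • u, q + s • v)) (u, v) s := by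
      have h3 : ∀ p u : Fin n → ℝ, HasDerivAt (fun s : ℝ => p + s • u) u s := fun p u => by
        simpa using ((hasDerivAt_id s).smul_const u).const_add p
      exact (h3 p u).prodMk (h3 q v)
    exact (hfd _ _).comp_hasDerivAt s h1
  -- Differentiate the cocycle identity at (p, q, sv) with respect to s at s = 0.
  have hright : ∀ p q v, D (p, q) (0, v) = linSymbol a (p + q) v - linSymbol a q v := by
    intro p q v
    have h1 := hline p q 0 v 0
    have h2 : (fun s : ℝ => bisymbol a (p + s • (0 : Fin n → ℝ)) (q + s • v)) = fun s : ℝ =>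
        bisymbol a (p + q) (s • v) + bisymbol a p q - bisymbol a q (s • v) := by
      ext s
      rw [smul_zero, add_zero]
      linarith [hcoc p q (s • v)]
    rw [h2] at h1
    have h3 := ((hasDerivAt_bisymbol_smul a (p + q) v).add_const (bisymbol a p q)).sub
      (hasDerivAt_bisymbol_smul a q v)
    simpa using h1.unique h3
  have hleft : ∀ p q u, D (p, q) (u, 0) = linSymbol a (p + q) u - linSymbol a p u := by
    intro p q u
    have h1 := hline p q u 0 0
    have h4 := hline q p 0 u 0
    have h2 : (fun s : ℝ => bisymbol a (p + s • u) (q + s • (0 : Fin n → ℝ))) =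
        fun s : ℝ => bisymbol a (q + s • (0 : Fin n → ℝ)) (p + s • u) := by
      ext s
      rw [hsymm]
    rw [h2] at h1
    have h5 := h1.unique h4
    rw [zero_smul, zero_smul, add_zero, add_zero, hright, add_comm q p] at h5
    exact h5
  -- Along the ray s ↦ (sξ, sη) both sides have derivative L(s(ξ+η), ξ+η) − L(sξ, ξ) − L(sη, η). At
  -- s = 0 both equal b(0,0), which fixes the constant term of `primSymbol`.
  have hK : ∀ s : ℝ, HasDerivAt (fun s : ℝ => bisymbol a (s • ξ) (s • η) -
      (primSymbol a (s • ξ) + primSymbol a (s • η) - primSymbol a (s • (ξ + η)))) 0 s := by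
    intro s
    have h1 := hline 0 0 ξ η s
    simp only [zero_add] at h1
    refine (h1.sub (((hasDerivAt_primSymbol_smul a ξ s).add
      (hasDerivAt_primSymbol_smul a η s)).sub
        (hasDerivAt_primSymbol_smul a (ξ + η) s))).congr_deriv ?_
    have h2 : ((ξ, η) : (Fin n → ℝ) × (Fin n → ℝ)) = (ξ, 0) + (0, η) := by simp
    have h3 : ∀ p : Fin n → ℝ, linSymbol a p (ξ + η) = linSymbol a p ξ + linSymbol a p η := by
      intro p
      simp only [linSymbol, Pi.add_apply, mul_add, Finset.sum_add_distrib]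
    rw [h2, map_add, hleft, hright, ← smul_add, h3]
    ring
  have h0 := is_const_of_deriv_eq_zero (fun s => (hK s).differentiableAt)
    (fun s => (hK s).deriv) 1 0
  have hb : bisymbol a 0 0 = a (emptyWord n _, emptyWord n _) := by
    have : ∀ {j : ℕ} (w : Fin j → Fin n), wordMonomial (0 : Fin n → ℝ) w = 0 ^ j := fun w => by
      simp [wordMonomial]
    simp only [bisymbol, this]
    rw [Fintype.sum_prod_type]
    simp only [← mul_assoc, sum_zero_pow_length]
  have ht : primSymbol a 0 = a (emptyWord n _, emptyWord n _) := by
    simp [primSymbol]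
  simp only [one_smul, zero_smul, hb, ht] at h0
  linarith

end Symbols

/-! ### Exponentials as test functions -/

section Exponentials

variable {φ : OpenPartialHomeomorph M (EuclideanSpace ℝ (Fin n))} {x : M} {k : ℕ}

/-- Near `x`, the function `f` is the exponential with frequency `ξ` centred at `x`. -/
def IsExpAt (φ : OpenPartialHomeomorph M (EuclideanSpace ℝ (Fin n))) (x : M) (ξ : Fin n → ℝ)
    (f : M → ℝ) : Prop :=
  f =ᶠ[nhds x] fun y => Real.exp (∑ i, ξ i * (φ y i - φ x i))

theorem IsExpAt.eq_one {ξ : Fin n → ℝ} {f : M → ℝ} (hf : IsExpAt φ x ξ f) : f x = 1 := by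
  simpa using hf.eq_of_nhds

theorem IsExpAt.mul {ξ η : Fin n → ℝ} {f g : M → ℝ} (hf : IsExpAt φ x ξ f)
    (hg : IsExpAt φ x η g) : IsExpAt φ x (ξ + η) (f * g) := by
  filter_upwards [hf, hg] with y hy hy'
  rw [Pi.mul_apply, hy, hy', ← Real.exp_add, ← Finset.sum_add_distrib]
  simp only [Pi.add_apply, add_mul]

theorem pd_exp {y : M} (hy : y ∈ φ.source) (ξ : Fin n → ℝ) (c : EuclideanSpace ℝ (Fin n))
    (C : ℝ) (j : Fin n) :
    pd φ j (fun z => C * Real.exp (∑ i, ξ i * (φ z i - c i))) y =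
      ξ j * (C * Real.exp (∑ i, ξ i * (φ y i - c i))) := by
  have h1 : (fun z => C * Real.exp (∑ i, ξ i * (φ z i - c i))) ∘ φ.symm =ᶠ[nhds (φ y)]
      fun z => C * Real.exp (∑ i, ξ i * (z i - c i)) := by
    filter_upwards [φ.open_target.mem_nhds (φ.map_source hy)] with z hz
    simp [φ.right_inv hz]
  have h2 : HasFDerivAt (fun z : EuclideanSpace ℝ (Fin n) => ∑ i, ξ i * (z i - c i))
      (∑ i, ξ i • (EuclideanSpace.proj (𝕜 := ℝ) i : EuclideanSpace ℝ (Fin n) →L[ℝ] ℝ)) (φ y) :=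
    HasFDerivAt.fun_sum fun i _ =>
      (((EuclideanSpace.proj (𝕜 := ℝ) i).hasFDerivAt (x := φ y)).sub_const (c i)).const_mul (ξ i)
  rw [pd, h1.fderiv_eq, (h2.exp.const_mul C).fderiv]
  simp
  ring

variable [ChartedSpace (EuclideanSpace ℝ (Fin n)) M]

theorem contMDiffAt_exp (hφ : φ ∈ IsManifold.maximalAtlas (𝓡 n) ∞ M) {y : M}
    (hy : y ∈ φ.source) (ξ : Fin n → ℝ) (c : EuclideanSpace ℝ (Fin n)) :
    ContMDiffAt (𝓡 n) 𝓘(ℝ, ℝ) ∞ (fun z => Real.exp (∑ i, ξ i * (φ z i - c i))) y := by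
  refine contMDiffAt_comp_chart hφ hy (F := fun z => Real.exp (∑ i, ξ i * (z i - c i))) ?_
  refine ContDiffAt.exp (ContDiffAt.sum fun i _ => contDiffAt_const.mul (ContDiffAt.sub ?_
    contDiffAt_const))
  exact (EuclideanSpace.proj (𝕜 := ℝ) i).contDiff.contDiffAt

theorem chartDeriv_exp (hφ : φ ∈ IsManifold.maximalAtlas (𝓡 n) ∞ M) (ξ : Fin n → ℝ)
    (c : EuclideanSpace ℝ (Fin n)) {j : ℕ} (w : Fin j → Fin n) {y : M} (hy : y ∈ φ.source) :
    chartDeriv φ w (fun z => Real.exp (∑ i, ξ i * (φ z i - c i))) y =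
      wordMonomial ξ w * Real.exp (∑ i, ξ i * (φ y i - c i)) := by
  induction j generalizing y with
  | zero => simp [chartDeriv_zero hy, wordMonomial]
  | succ j ih =>
    rw [chartDeriv_succ hφ hy (contMDiffAt_exp hφ hy ξ c), pd_congr hy
      (g := fun z => wordMonomial ξ (Fin.tail w) * Real.exp (∑ i, ξ i * (φ z i - c i))),
      pd_exp hy, ← mul_assoc, ← wordMonomial_cons, Fin.cons_self_tail]
    filter_upwards [φ.open_source.mem_nhds hy] with z hz using ih (Fin.tail w) hz

theorem IsExpAt.jet_eq (hφ : φ ∈ IsManifold.maximalAtlas (𝓡 n) ∞ M) (hx : x ∈ φ.source)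
    {ξ : Fin n → ℝ} {f : Fn n M} (hf : IsExpAt φ x ξ f) (w : Word n k) :
    jet φ k w f x = wordMonomial ξ w.2 := by
  rw [jet, chartDeriv_congr hx hf, chartDeriv_exp hφ ξ (φ x) w.2 hx]
  simp

/-- A bump function supported in the chart domain and equal to 1 near x extends the local
exponential to all of M. -/
theorem exists_isExpAt [T2Space M] [IsManifold (𝓡 n) ∞ M]
    (hφ : φ ∈ IsManifold.maximalAtlas (𝓡 n) ∞ M)
    (hx : x ∈ φ.source) (ξ : Fin n → ℝ) : ∃ f : Fn n M, IsExpAt φ x ξ f := by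
  obtain ⟨χ, hχ⟩ : ∃ χ : SmoothBumpFunction (𝓡 n) x, tsupport χ ⊆ φ.source :=
    (SmoothBumpFunction.nhds_basis_tsupport (I := 𝓡 n) x).mem_iff.1
      (φ.open_source.mem_nhds hx) |>.imp fun _ h => h.2
  refine ⟨⟨fun y => χ y • Real.exp (∑ i, ξ i * (φ y i - φ x i)), ?_⟩, ?_⟩
  · refine contMDiff_of_tsupport fun y hy => ?_
    have hy' : y ∈ φ.source := hχ (tsupport_smul_subset_left _ _ hy)
    exact χ.contMDiff.contMDiffAt.smul (contMDiffAt_exp hφ hy' ξ (φ x))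
  · filter_upwards [χ.eventuallyEq_one] with y hy
    simp [hy]

/-- The iterated coordinate derivative along a list of indices. -/
def listDeriv (φ : OpenPartialHomeomorph M (EuclideanSpace ℝ (Fin n))) (l : List (Fin n))
    (f : M → ℝ) : M → ℝ :=
  l.foldr (pd φ) f

theorem contMDiffAt_listDeriv (hφ : φ ∈ IsManifold.maximalAtlas (𝓡 n) ∞ M) (l : List (Fin n))
    (f : Fn n M) (hx : x ∈ φ.source) :
    ContMDiffAt (𝓡 n) 𝓘(ℝ, ℝ) ∞ (listDeriv φ l f) x := by
  induction l with
  | nil => exact f.contMDiff x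
  | cons i l ih => exact contMDiffAt_pd hφ hx ih i

theorem listDeriv_perm (hφ : φ ∈ IsManifold.maximalAtlas (𝓡 n) ∞ M) {l l' : List (Fin n)}
    (h : l.Perm l') (f : Fn n M) (hx : x ∈ φ.source) :
    listDeriv φ l f x = listDeriv φ l' f x := by
  induction h generalizing x with
  | nil => rfl
  | cons i _ ih =>
    refine pd_congr hx ?_ i
    filter_upwards [φ.open_source.mem_nhds hx] with y hy using ih hy
  | swap i j l => exact pd_comm hφ hx (contMDiffAt_listDeriv hφ l f hx) j i
  | trans _ _ ih ih' => exact (ih hx).trans (ih' hx)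

theorem chartDeriv_eq_listDeriv (hφ : φ ∈ IsManifold.maximalAtlas (𝓡 n) ∞ M) (f : Fn n M)
    {j : ℕ} (w : Fin j → Fin n) (hx : x ∈ φ.source) :
    chartDeriv φ w f x = listDeriv φ (List.ofFn w) f x := by
  induction j generalizing x with
  | zero => simp [chartDeriv_zero hx, listDeriv]
  | succ j ih =>
    rw [chartDeriv_succ hφ hx (f.contMDiff x), List.ofFn_succ]
    refine pd_congr hx ?_ (w 0)
    filter_upwards [φ.open_source.mem_nhds hx] with y hy using ih (Fin.tail w) hy

/-- A linear combination of derivatives at a point vanishes if its symbol does. -/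
theorem sum_jet_eq_zero (hφ : φ ∈ IsManifold.maximalAtlas (𝓡 n) ∞ M) (hx : x ∈ φ.source)
    (c : Word n k → ℝ) (hc : ∀ ξ : Fin n → ℝ, ∑ w, c w * wordMonomial ξ w.2 = 0) (f : Fn n M) :
    ∑ w, c w * jet φ k w f x = 0 := by
  -- Different words may represent one multi-index, so the coefficients `c w` need not vanish
  -- individually. `L` sends a monomial to the corresponding derivative of `f` at x; commuting
  -- partial derivatives make this agree with every word, and the sum then depends only on the
  -- polynomial symbol.
  let L : MvPolynomial (Fin n) ℝ →ₗ[ℝ] ℝ := (MvPolynomial.basisMonomials (Fin n) ℝ).constr ℝ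
    fun m => listDeriv φ (Finsupp.toMultiset m).toList f x
  have hL : ∀ w : Word n k, L (∏ i, MvPolynomial.X (w.2 i)) = jet φ k w f x := by
    intro w
    have h1 : (∏ i, MvPolynomial.X (w.2 i) : MvPolynomial (Fin n) ℝ) =
        MvPolynomial.basisMonomials (Fin n) ℝ (∑ i, Finsupp.single (w.2 i) 1) := by
      rw [MvPolynomial.coe_basisMonomials]
      dsimp only
      rw [MvPolynomial.monomial_sum_one]
      rfl
    rw [h1, Module.Basis.constr_basis, jet, chartDeriv_eq_listDeriv hφ f w.2 hx]
    refine listDeriv_perm hφ (Multiset.coe_eq_coe.1 ?_) f hx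
    rw [Multiset.coe_toList, map_sum, ← Fin.univ_val_map]
    simp only [Finsupp.toMultiset_single, one_smul]
    exact (Multiset.sum_map_singleton (Finset.univ.val.map w.2)).symm.trans (by
      rw [Multiset.map_map]; rfl) |>.symm
  -- A polynomial over the infinite field ℝ that vanishes at every point is zero.
  have hP : (∑ w, c w • ∏ i, MvPolynomial.X (w.2 i) : MvPolynomial (Fin n) ℝ) = 0 := by
    refine MvPolynomial.funext fun ξ => ?_
    simpa [MvPolynomial.smul_eval, wordMonomial] using hc ξ
  simpa [hL] using congrArg L hP

/-- A combination of derivatives which vanishes on exponentials vanishes. -/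
theorem IsComb.eq_zero_of_isExpAt [T2Space M] [IsManifold (𝓡 n) ∞ M]
    (hφ : φ ∈ IsManifold.maximalAtlas (𝓡 n) ∞ M) (hx : x ∈ φ.source) {F : Fn n M → M → ℝ}
    (hF : IsComb (n := n) φ.source (jet φ k) F)
    (h : ∀ (ξ : Fin n → ℝ) (f : Fn n M), IsExpAt φ x ξ f → F f x = 0) (f : Fn n M) :
    F f x = 0 := by
  obtain ⟨a, -, ha⟩ := hF
  rw [ha f x hx]
  refine sum_jet_eq_zero hφ hx (fun w => a w x) (fun ξ => ?_) f
  obtain ⟨e, he⟩ := exists_isExpAt hφ hx ξ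
  rw [← h ξ e he, ha e x hx]
  exact Finset.sum_congr rfl fun w _ => by rw [he.jet_eq hφ hx]

end Exponentials

/-! ### The local primitive of a symmetric cocycle -/

section Primitive

variable [ChartedSpace (EuclideanSpace ℝ (Fin n)) M]
  {φ : OpenPartialHomeomorph M (EuclideanSpace ℝ (Fin n))} {k : ℕ}
  {a : Word n (k + 1) × Word n (k + 1) → M → ℝ} {x : M}

/-- In the chart `φ`, the primitive of the symmetric bidifferential Hochschild cocycle with
coefficients `a`. -/
def primitive (φ : OpenPartialHomeomorph M (EuclideanSpace ℝ (Fin n)))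
    (a : Word n (k + 1) × Word n (k + 1) → M → ℝ) (f : Fn n M) (x : M) : ℝ :=
  a (emptyWord n _, emptyWord n _) x * f x + ∑ w, ∑ j,
    (-((w.1 : ℕ) + 1 : ℝ)⁻¹ * a (w, letter k j) x) *
      chartDeriv φ (Fin.cons j w.2 : Fin (w.1 + 1) → Fin n) f x

theorem isComb_primitive (ha : ∀ p, ∀ x ∈ φ.source, ContMDiffAt (𝓡 n) 𝓘(ℝ, ℝ) ∞ (a p) x) :
    IsComb (n := n) φ.source (jet φ (k + 2)) (primitive φ a) := by
  have h0 : IsComb (n := n) φ.source (jet φ (k + 2)) (fun (f : Fn n M) x => f x) :=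
    (isComb_chartDeriv (Nat.zero_le _) Fin.elim0).congr fun f x hx => by rw [chartDeriv_zero hx]
  refine (h0.mul_left (ha _)).add (IsComb.sum _ fun w _ => IsComb.sum _ fun j _ => ?_)
  exact (isComb_chartDeriv (Nat.succ_le_succ (Nat.le_of_lt_succ w.1.2)) _).mul_left
    fun x hx => contMDiffAt_const.mul (ha _ x hx)

theorem contMDiffAt_primitive (hφ : φ ∈ IsManifold.maximalAtlas (𝓡 n) ∞ M)
    (ha : ∀ p, ∀ x ∈ φ.source, ContMDiffAt (𝓡 n) 𝓘(ℝ, ℝ) ∞ (a p) x) (f : Fn n M)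
    (hx : x ∈ φ.source) : ContMDiffAt (𝓡 n) 𝓘(ℝ, ℝ) ∞ (primitive φ a f) x := by
  refine ((ha _ x hx).mul (f.contMDiff x)).add
    (ContMDiffAt.sum fun w _ => ContMDiffAt.sum fun j _ => ?_)
  exact (contMDiffAt_const.mul (ha _ x hx)).mul
    (contMDiffAt_chartDeriv hφ hx (fun y _ => f.contMDiff y) _)

theorem IsExpAt.primitive_eq (hφ : φ ∈ IsManifold.maximalAtlas (𝓡 n) ∞ M) (hx : x ∈ φ.source)
    {ξ : Fin n → ℝ} {f : Fn n M} (hf : IsExpAt φ x ξ f) :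
    primitive φ a f x = primSymbol (fun p => a p x) ξ := by
  have h1 : ∀ {j : ℕ} (w : Fin j → Fin n), chartDeriv φ w f x = wordMonomial ξ w := fun w => by
    rw [chartDeriv_congr hx hf, chartDeriv_exp hφ ξ (φ x) w hx]
    simp
  rw [primitive, primSymbol, hf.eq_one, mul_one, sub_eq_add_neg, ← Finset.sum_neg_distrib]
  refine congrArg _ (Finset.sum_congr rfl fun w _ => ?_)
  rw [← Finset.sum_neg_distrib]
  refine Finset.sum_congr rfl fun j _ => ?_
  rw [h1, wordMonomial_cons, div_eq_mul_inv]
  ring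

theorem chartDeriv_smul_add (hφ : φ ∈ IsManifold.maximalAtlas (𝓡 n) ∞ M) (hx : x ∈ φ.source)
    {j : ℕ} (w : Fin j → Fin n) (r : ℝ) (f g : Fn n M) :
    chartDeriv φ w (r • f + g : Fn n M) x = r * chartDeriv φ w f x + chartDeriv φ w g x := by
  have hf : ContDiffAt ℝ j (f ∘ φ.symm) (φ x) :=
    (contDiffAt_comp_symm hφ hx (f.contMDiff x)).of_le (mod_cast le_top)
  have hg : ContDiffAt ℝ j (g ∘ φ.symm) (φ x) :=
    (contDiffAt_comp_symm hφ hx (g.contMDiff x)).of_le (mod_cast le_top)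
  have h1 : (r • f + g : Fn n M) ∘ φ.symm = r • (f ∘ φ.symm) + g ∘ φ.symm := rfl
  have hrf : ContDiffAt ℝ j (r • (f ∘ φ.symm)) (φ x) := hf.const_smul r
  rw [chartDeriv, h1, iteratedFDeriv_add_apply hrf hg, iteratedFDeriv_const_smul_apply hf]
  rfl

theorem primitive_smul_add (hφ : φ ∈ IsManifold.maximalAtlas (𝓡 n) ∞ M) (hx : x ∈ φ.source)
    (r : ℝ) (f g : Fn n M) :
    primitive φ a (r • f + g) x = r * primitive φ a f x + primitive φ a g x := by
  have h1 : (r • f + g : Fn n M) x = r * f x + g x := rfl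
  simp only [primitive, chartDeriv_smul_add hφ hx, h1, mul_add, Finset.sum_add_distrib,
    Finset.mul_sum, mul_left_comm r]
  ring

variable [T2Space M] [IsManifold (𝓡 n) ∞ M]

/-- A symmetric bidifferential Hochschild cocycle is, in every chart, the coboundary of
`primitive`. -/
theorem eq_coboundary_primitive (hφ : φ ∈ IsManifold.maximalAtlas (𝓡 n) ∞ M) (hx : x ∈ φ.source)
    {B : Fn n M → Fn n M → Fn n M}
    (ha : ∀ p, ∀ x ∈ φ.source, ContMDiffAt (𝓡 n) 𝓘(ℝ, ℝ) ∞ (a p) x)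
    (hB : ∀ f : Fn n M × Fn n M, ∀ x ∈ φ.source,
      B f.1 f.2 x = ∑ p, a p x * bijet φ (k + 1) p f x)
    (hsymm : ∀ f g, B f g = B g f)
    (hcoc : ∀ f g h, B (f * g) h + B f g * h = B f (g * h) + f * B g h) (f g : Fn n M) :
    B f g x = f x * primitive φ a g x + primitive φ a f x * g x - primitive φ a (f * g) x := by
  have hexp : ∀ {ξ η : Fin n → ℝ} {f g : Fn n M}, IsExpAt φ x ξ f → IsExpAt φ x η g →
      B f g x = bisymbol (fun p => a p x) ξ η := by
    intro ξ η f g hf hg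
    rw [hB (f, g) x hx]
    exact Finset.sum_congr rfl fun p _ => by rw [bijet, hf.jet_eq hφ hx, hg.jet_eq hφ hx]
  have hmul : ∀ {ξ η : Fin n → ℝ} {f g : Fn n M}, IsExpAt φ x ξ f → IsExpAt φ x η g →
      IsExpAt φ x (ξ + η) (f * g : Fn n M) := fun hf hg => by
    rw [ContMDiffMap.coe_mul]
    exact hf.mul hg
  have hbs : ∀ ξ η, bisymbol (fun p => a p x) ξ η = bisymbol (fun p => a p x) η ξ := by
    intro ξ η
    obtain ⟨f, hf⟩ := exists_isExpAt hφ hx ξ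
    obtain ⟨g, hg⟩ := exists_isExpAt hφ hx η
    rw [← hexp hf hg, ← hexp hg hf, hsymm]
  have hbc : ∀ ξ η ζ, bisymbol (fun p => a p x) (ξ + η) ζ + bisymbol (fun p => a p x) ξ η =
      bisymbol (fun p => a p x) ξ (η + ζ) + bisymbol (fun p => a p x) η ζ := by
    intro ξ η ζ
    obtain ⟨f, hf⟩ := exists_isExpAt hφ hx ξ
    obtain ⟨g, hg⟩ := exists_isExpAt hφ hx η
    obtain ⟨h, hh⟩ := exists_isExpAt hφ hx ζ
    rw [← hexp (hmul hf hg) hh, ← hexp hf hg, ← hexp hf (hmul hg hh), ← hexp hg hh]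
    have := congrArg (fun u : Fn n M => u x) (hcoc f g h)
    simpa [hf.eq_one, hh.eq_one] using this
  -- `E` is the defect B − δ(`primitive`). For fixed `g` it is a differential operator in `f`, so it
  -- can be tested on exponentials.
  let E : Fn n M → Fn n M → M → ℝ := fun g f x =>
    B f g x + (-1) * (f x * primitive φ a g x + primitive φ a f x * g x) + primitive φ a (f * g) x
  have hE : ∀ g, IsComb (n := n) φ.source (jet φ (k + 2)) (E g) := by
    intro g
    have hprim := isComb_primitive (φ := φ) ha
    have hval : IsComb (n := n) φ.source (jet φ 0) (fun (f : Fn n M) x => f x) :=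
      (isComb_chartDeriv (Nat.zero_le _) Fin.elim0).congr fun f x hx => by rw [chartDeriv_zero hx]
    have h1 : IsComb (n := n) φ.source (jet φ (k + 2)) (fun f => B f g) := by
      have hB' : IsComb (n := n) φ.source (bijet φ (k + 1)) (fun f => B f.1 f.2) := ⟨a, ha, hB⟩
      refine (hB'.precomp fun f => (f, g)).trans fun p => ?_
      refine ((isComb_jet_of_le (Nat.le_succ _) p.1).mul_left
        fun x hx => contMDiffAt_jet hφ p.2 g hx).congr fun f x _ => ?_
      exact mul_comm _ _
    have h2 : IsComb (n := n) φ.source (jet φ (k + 2)) (fun f x => f x * primitive φ a g x) :=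
      ((hval.trans (isComb_jet_of_le (Nat.zero_le _))).mul_left
        fun x hx => contMDiffAt_primitive hφ ha g hx).congr fun f x _ => mul_comm _ _
    have h3 : IsComb (n := n) φ.source (jet φ (k + 2)) (fun f x => primitive φ a f x * g x) :=
      (hprim.mul_left fun x _ => g.contMDiff x).congr fun f x _ => mul_comm _ _
    have h4 : IsComb (n := n) φ.source (jet φ (k + 2)) (fun f => primitive φ a (f * g)) := by
      have hmulg : IsComb (n := n) φ.source (jet φ 0) (fun f : Fn n M => (f * g : Fn n M)) :=
        (hval.mul_left fun x _ => g.contMDiff x).congr fun f x _ => mul_comm _ _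
      refine (hprim.precomp (· * g)).trans fun w => ?_
      have := hmulg.chartDeriv_of_jet (F := (· * g)) hφ w
      rwa [Nat.zero_add] at this
    exact (h1.add ((h2.add h3).mul_left (c := fun _ => -1) fun x _ => contMDiffAt_const)).add h4
  have hEsymm : ∀ f g, E g f x = E f g x := by
    intro f g
    simp only [E, hsymm f g, mul_comm f g]
    ring
  have hEexp : ∀ (η : Fin n → ℝ) (g : Fn n M), IsExpAt φ x η g → ∀ f, E g f x = 0 := by
    intro η g hg
    refine (hE g).eq_zero_of_isExpAt hφ hx fun ξ f hf => ?_
    simp only [E]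
    rw [hexp hf hg, hf.eq_one, hg.eq_one, hf.primitive_eq hφ hx, hg.primitive_eq hφ hx,
      (hmul hf hg).primitive_eq hφ hx, bisymbol_eq_coboundary _ hbs hbc]
    ring
  -- The exponential test is applied once in each variable: `hEexp` covers exponential `g` and
  -- arbitrary `f`, and the symmetry of the defect exchanges the two roles.
  have := (hE g).eq_zero_of_isExpAt hφ hx (fun ξ f hf => by rw [hEsymm, hEexp ξ f hf]) f
  simp only [E] at this
  linarith

end Primitive

/-! ### Gluing by a partition of unity -/

section Global

variable [ChartedSpace (EuclideanSpace ℝ (Fin n)) M] [T2Space M] [SecondCountableTopology M]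
  [IsManifold (𝓡 n) ∞ M]

/-- A symmetric bidifferential Hochschild cocycle is the coboundary of a differential operator. -/
theorem exists_isDiffOp_coboundary {B : Fn n M → Fn n M → Fn n M} (hB : IsBidiffOp B)
    (hsymm : ∀ f g, B f g = B g f)
    (hcoc : ∀ f g h, B (f * g) h + B f g * h = B f (g * h) + f * B g h) :
    ∃ D : Fn n M →ₗ[ℝ] Fn n M, IsDiffOp D ∧ ∀ f g, B f g = f * D g + D f * g - D (f * g) := by
  -- Order at least 1 ensures that words of length one are available for the linear part of the
  -- symbol.
  obtain ⟨k', hk', h⟩ := hB.exists_order_le 1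
  obtain ⟨k, rfl⟩ : ∃ k, k' = k + 1 := ⟨k' - 1, by omega⟩
  have hchart : ∀ c : M, chartAt (EuclideanSpace ℝ (Fin n)) c ∈ IsManifold.maximalAtlas (𝓡 n) ∞ M :=
    fun c => IsManifold.chart_mem_maximalAtlas c
  choose a ha hBa using fun c => h _ (hchart c)
  have : LocallyCompactSpace M := Manifold.locallyCompact_of_finiteDimensional (𝓡 n)
  have : SigmaCompactSpace M := sigmaCompactSpace_of_locallyCompact_secondCountable
  obtain ⟨ρ, hρ⟩ := SmoothPartitionOfUnity.exists_isSubordinate_chartAt_source (𝓡 n) M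
  let t : M → Fn n M → M → ℝ := fun c =>
    primitive (chartAt (EuclideanSpace ℝ (Fin n)) c) (a c)
  have hsum : ∀ x : M, ∃ s : Finset M,
      (∀ c ∈ s, x ∈ (chartAt (EuclideanSpace ℝ (Fin n)) c).source) ∧ ∑ c ∈ s, ρ c x = 1 ∧
      ∀ u : M → ℝ, ∑ᶠ c, ρ c x • u c = ∑ c ∈ s, ρ c x * u c := by
    intro x
    have hs : ∀ u : M → ℝ, (Function.support fun c => ρ c x * u c) ⊆
        (ρ.locallyFinite.point_finite x).toFinset := fun u c hc => by
      simpa using left_ne_zero_of_mul hc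
    refine ⟨(ρ.locallyFinite.point_finite x).toFinset, fun c hc => ?_, ?_, fun u =>
      finsum_eq_sum_of_support_subset _ (hs u)⟩
    · exact hρ _ (subset_tsupport _ (by simpa using hc))
    · rw [← ρ.sum_eq_one (Set.mem_univ x)]
      exact (finsum_eq_sum_of_support_subset _ (by simp)).symm
  choose s hs hs1 hsum using hsum
  let T : Fn n M → Fn n M := fun f => ⟨fun x => ∑ᶠ c, ρ c x • t c f x, fun x =>
    ρ.contMDiffAt_finsum fun c hc => contMDiffAt_primitive (hchart c) (ha c) f (hρ c hc)⟩
  have hT : ∀ f x, T f x = ∑ c ∈ s x, ρ c x * t c f x := fun f x => hsum x fun c => t c f x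
  have hlin : ∀ (r : ℝ) f g, T (r • f + g) = r • T f + T g := by
    intro r f g
    ext x
    change T (r • f + g) x = r * T f x + T g x
    rw [hT, hT, hT, Finset.mul_sum, ← Finset.sum_add_distrib]
    refine Finset.sum_congr rfl fun c hc => ?_
    simp only [t]
    rw [primitive_smul_add (hchart c) (hs x c hc)]
    ring
  have hadd : ∀ f g, T (f + g) = T f + T g := fun f g => by simpa using hlin 1 f g
  have hzero : T 0 = 0 := by simpa only [add_zero, left_eq_add] using hadd 0 0
  have hsmul : ∀ (r : ℝ) f, T (r • f) = r • T f := fun r f => by simpa [hzero] using hlin r f 0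
  refine ⟨⟨⟨T, hadd⟩, hsmul⟩, ?_, fun f g => ?_⟩
  · change IsDiffOp T
    -- The order `k + 1` of `B` is the same in every chart and each local primitive adds one, so `k
    -- + 2` bounds the order of the glued operator uniformly.
    refine isDiffOp_iff.2 ⟨k + 2, fun ψ hψ => ?_⟩
    have h1 : ∀ c, IsComb (n := n) ((chartAt (EuclideanSpace ℝ (Fin n)) c).source ∩ ψ.source)
        (jet ψ (k + 2)) (t c) := fun c =>
      ((isComb_primitive (ha c)).mono Set.inter_subset_left).trans fun w => by
        rw [Set.inter_comm]
        exact isComb_jet_change_chart hψ (hchart c) w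
    choose b hb hb' using h1
    refine ⟨fun w x => ∑ᶠ c, ρ c x • b c w x, fun w x hx => ?_, fun f x hx => ?_⟩
    · exact ρ.contMDiffAt_finsum fun c hc => hb c w x ⟨hρ c hc, hx⟩
    · refine (hT f x).trans ?_
      simp only [hsum, Finset.sum_mul]
      rw [Finset.sum_comm]
      refine Finset.sum_congr rfl fun c hc => ?_
      rw [hb' c f x ⟨hs x c hc, hx⟩, Finset.mul_sum]
      simp only [mul_assoc]
  · ext x
    change B f g x = f x * T g x + T f x * g x - T (f * g) x
    -- Writing B as ∑ ρ_c B reduces the identity to the local one, since δ commutes with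
    -- multiplication of operators by functions.
    rw [← one_mul (B f g x), ← hs1 x, hT, hT, hT, Finset.sum_mul, Finset.sum_mul, Finset.mul_sum,
      ← Finset.sum_add_distrib, ← Finset.sum_sub_distrib]
    refine Finset.sum_congr rfl fun c hc => ?_
    rw [eq_coboundary_primitive (hchart c) (hs x c hc) (ha c) (hBa c) hsymm hcoc f g]
    ring

end Global

/-! ### The automorphism id + ħD of formal power series -/

section FormalSeries

open PowerSeries

variable {R A : Type*} [CommRing R] [CommRing A] [Algebra R A]

theorem X_smul_powerSeries (u : A⟦X⟧) : (X : R⟦X⟧) • u = X * u := by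
  rw [Algebra.smul_def]
  congr 1
  exact PowerSeries.map_X _

/-- The coefficientwise extension of a linear map to formal power series. -/
def onCoeffs (D : A →ₗ[R] A) : A⟦X⟧ →ₗ[R⟦X⟧] A⟦X⟧ where
  toFun u := PowerSeries.mk fun i => D (coeff i u)
  map_add' u v := by ext i; simp
  map_smul' r u := by
    ext i
    simp only [RingHom.id_apply, Algebra.smul_def, coeff_mk, coeff_mul, map_sum]
    refine Finset.sum_congr rfl fun p _ => ?_
    have h : coeff p.1 (algebraMap R⟦X⟧ A⟦X⟧ r) = algebraMap R A (coeff p.1 r) :=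
      PowerSeries.coeff_map _ _ _
    rw [h, ← Algebra.smul_def, ← Algebra.smul_def, map_smul]

/-- The coefficients of the inverse of `id + ħ D`. -/
def invCoeff (D : A →ₗ[R] A) (u : A⟦X⟧) : ℕ → A
  | 0 => coeff 0 u
  | m + 1 => coeff (m + 1) u - D (invCoeff D u m)

theorem coeff_zero_add_X_smul (D : A →ₗ[R] A) (u : A⟦X⟧) :
    coeff 0 (u + (X : R⟦X⟧) • onCoeffs D u) = coeff 0 u := by
  simp [X_smul_powerSeries]

theorem coeff_succ_add_X_smul (D : A →ₗ[R] A) (u : A⟦X⟧) (m : ℕ) :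
    coeff (m + 1) (u + (X : R⟦X⟧) • onCoeffs D u) = coeff (m + 1) u + D (coeff m u) := by
  simp [X_smul_powerSeries, coeff_succ_X_mul, onCoeffs]

/-- The automorphism `id + ħ D` of the module of formal power series. -/
def idAddHbar (D : A →ₗ[R] A) : A⟦X⟧ ≃ₗ[R⟦X⟧] A⟦X⟧ where
  __ := LinearMap.id + (X : R⟦X⟧) • onCoeffs D
  invFun u := PowerSeries.mk (invCoeff D u)
  left_inv u := by
    ext m
    rw [coeff_mk]
    induction m with
    | zero => exact coeff_zero_add_X_smul D u
    | succ m ih =>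
      rw [invCoeff, ih]
      exact sub_eq_of_eq_add (coeff_succ_add_X_smul D u m)
  right_inv u := by
    ext m
    cases m with
    | zero => exact (coeff_zero_add_X_smul D _).trans (coeff_mk _ _)
    | succ m =>
      refine (coeff_succ_add_X_smul D _ m).trans ?_
      simp only [LinearMap.id_apply, coeff_mk, invCoeff, sub_add_cancel]

theorem coeff_zero_idAddHbar (D : A →ₗ[R] A) (u : A⟦X⟧) :
    coeff 0 (idAddHbar D u) = coeff 0 u :=
  coeff_zero_add_X_smul D u

theorem coeff_succ_idAddHbar (D : A →ₗ[R] A) (u : A⟦X⟧) (m : ℕ) :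
    coeff (m + 1) (idAddHbar D u) = coeff (m + 1) u + D (coeff m u) :=
  coeff_succ_add_X_smul D u m

theorem coeff_zero_idAddHbar_symm (D : A →ₗ[R] A) (u : A⟦X⟧) :
    coeff 0 ((idAddHbar D).symm u) = coeff 0 u :=
  coeff_mk _ _

theorem coeff_succ_idAddHbar_symm (D : A →ₗ[R] A) (u : A⟦X⟧) (m : ℕ) :
    coeff (m + 1) ((idAddHbar D).symm u) =
      coeff (m + 1) u - D (coeff m ((idAddHbar D).symm u)) := by
  refine (coeff_mk _ _).trans ?_
  rw [invCoeff]
  exact congrArg (fun z => _ - D z) (coeff_mk _ _).symm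

/-- An `R⟦X⟧`-linear map is determined by its values on constant power series. -/
theorem coeff_linearMap (L : A⟦X⟧ →ₗ[R⟦X⟧] A⟦X⟧) (m : ℕ) (u : A⟦X⟧) :
    coeff m (L u) = ∑ p ∈ Finset.HasAntidiagonal.antidiagonal m, coeff p.1 (L (C (coeff p.2 u))) := by
  have hu : ∀ u : A⟦X⟧, L u =
      X * L (PowerSeries.mk fun p => coeff (p + 1) u) + L (C (coeff 0 u)) := fun u => by
    conv_lhs => rw [eq_X_mul_shift_add_const u, ← X_smul_powerSeries (R := R), map_add, map_smul,
      X_smul_powerSeries]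
    simp
  induction m generalizing u with
  | zero => rw [hu u]; simp
  | succ m ih =>
    rw [Finset.Nat.sum_antidiagonal_succ', hu u, map_add, coeff_succ_X_mul, ih, add_comm]
    simp

end FormalSeries

/-! ### First-order terms and transport of star products -/

namespace StarProduct

open PowerSeries

variable [ChartedSpace (EuclideanSpace ℝ (Fin n)) M] [IsManifold (𝓡 n) ∞ M]
  (S : StarProduct n M)

theorem coeff_mul (m : ℕ) (u v : (Fn n M)⟦X⟧) :
    coeff m (S.mul u v) = ∑ p ∈ Finset.HasAntidiagonal.antidiagonal m, ∑ q ∈ Finset.HasAntidiagonal.antidiagonal p.1,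
      S.B q.1 (coeff p.2 u) (coeff q.2 v) := by
  refine (coeff_linearMap (S.mul.flip v) m u).trans (Finset.sum_congr rfl fun p _ => ?_)
  exact coeff_linearMap (S.mul (C (coeff p.2 u))) p.1 v

theorem B_zero (f g : Fn n M) : S.B 0 f g = f * g :=
  S.zeroth f g

theorem coeff_zero_mul (u v : (Fn n M)⟦X⟧) :
    coeff 0 (S.mul u v) = coeff 0 u * coeff 0 v := by
  simp [S.coeff_mul, S.B_zero]

theorem coeff_one_mul (u v : (Fn n M)⟦X⟧) :
    coeff 1 (S.mul u v) = S.B 1 (coeff 0 u) (coeff 0 v) + coeff 0 u * coeff 1 v +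
      coeff 1 u * coeff 0 v := by
  rw [S.coeff_mul]
  simp [Finset.Nat.antidiagonal_succ, S.B_zero]
  ring

/-- The first-order operator of a star product is a Hochschild cocycle. -/
theorem B_one_cocycle (f g h : Fn n M) :
    S.B 1 (f * g) h + S.B 1 f g * h = S.B 1 f (g * h) + f * S.B 1 g h := by
  have h1 : ∀ f g, coeff 1 (S.mul (C f) (C g)) = S.B 1 f g := fun _ _ => rfl
  have h2 := congrArg (coeff 1) (S.mul_assoc (C f) (C g) (C h))
  simp only [S.coeff_one_mul (S.mul _ _), S.coeff_one_mul _ (S.mul _ _), S.coeff_zero_mul,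
    h1] at h2
  simpa [coeff_C] using h2

/-- The symmetric part of the first-order operator is a Hochschild cocycle. -/
theorem B1plus_cocycle (f g h : Fn n M) :
    S.B1plus (f * g) h + S.B1plus f g * h = S.B1plus f (g * h) + f * S.B1plus g h := by
  have h1 := S.B_one_cocycle f g h
  -- By commutativity of the pointwise product, the identity for the reversed triple is, up to sign,
  -- the cocycle identity of (f, g) ↦ B_1(g, f).
  have h2 := S.B_one_cocycle h g f
  rw [mul_comm h g, mul_comm g f] at h2
  simp only [B1plus, smul_mul_assoc, mul_smul_comm, ← smul_add]
  congr 1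
  linear_combination h1 - h2

theorem B1plus_comm (f g : Fn n M) : S.B1plus f g = S.B1plus g f := by
  rw [B1plus, B1plus, add_comm]

/-- The star product obtained from `S` by transport along `id + ħ D`. -/
def transport (D : Fn n M →ₗ[ℝ] Fn n M) (hD : IsDiffOp D) : StarProduct n M where
  mul := (S.mul.compl₁₂ (idAddHbar D).symm.toLinearMap (idAddHbar D).symm.toLinearMap).compr₂
    (idAddHbar D).toLinearMap
  mul_assoc u v w := by simp [S.mul_assoc]
  bidiff i := by
    -- On a constant series the recursion for the inverse gives the coefficients (−D)^m f.
    have hinv : ∀ m, IsDiffOp (fun f : Fn n M => coeff m ((idAddHbar D).symm (C f))) := by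
      intro m
      induction m with
      | zero =>
        simp only [coeff_zero_idAddHbar_symm, coeff_zero_C]
        exact isDiffOp_id
      | succ m ih =>
        simp only [coeff_succ_idAddHbar_symm, coeff_succ_C, zero_sub]
        exact (hD.comp ih).neg
    have hmul : ∀ m, IsBidiffOp (fun f g : Fn n M =>
        coeff m (S.mul ((idAddHbar D).symm (C f)) ((idAddHbar D).symm (C g)))) := by
      intro m
      simp only [S.coeff_mul]
      exact IsBidiffOp.sum _ fun p _ => IsBidiffOp.sum _ fun q _ =>
        IsBidiffOp.comp (S.bidiff q.1) (hinv p.2) (hinv q.2)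
    cases i with
    | zero => simpa [coeff_zero_idAddHbar, -coeff_zero_eq_constantCoeff] using hmul 0
    | succ i =>
      simp only [LinearMap.compr₂_apply, LinearMap.compl₁₂_apply, LinearEquiv.coe_coe,
        coeff_succ_idAddHbar]
      exact (hmul _).add (hD.comp_bidiffOp (hmul i))
  zeroth f g := by
    simp only [LinearMap.compr₂_apply, LinearMap.compl₁₂_apply, LinearEquiv.coe_coe,
      coeff_zero_idAddHbar, S.coeff_zero_mul, coeff_zero_idAddHbar_symm, coeff_zero_C]

theorem intertwines_transport (D : Fn n M →ₗ[ℝ] Fn n M) (hD : IsDiffOp D) :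
    Intertwines (idAddHbar D) S (S.transport D hD) := by
  intro u v
  simp [transport]

/-- Modulo ħ² the inverse is id − ħD: the two inner factors contribute −f·Dg − Df·g and the outer
one D(fg). -/
theorem transport_B_one (D : Fn n M →ₗ[ℝ] Fn n M) (hD : IsDiffOp D) (f g : Fn n M) :
    (S.transport D hD).B 1 f g = S.B 1 f g - (f * D g + D f * g - D (f * g)) := by
  have h1 : (S.transport D hD).B 1 f g = coeff (0 + 1) (idAddHbar D
    (S.mul ((idAddHbar D).symm (C f)) ((idAddHbar D).symm (C g)))) := rfl
  have h2 : ∀ f, coeff 1 ((idAddHbar D).symm (C f)) = -D f := fun f => by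
    rw [← zero_add 1, coeff_succ_idAddHbar_symm, coeff_zero_idAddHbar_symm]
    simp
  rw [h1, coeff_succ_idAddHbar, zero_add, S.coeff_one_mul, S.coeff_zero_mul, h2, h2]
  simp only [coeff_zero_idAddHbar_symm, coeff_zero_C]
  ring

end StarProduct

/-! ### Gauge transformations of the form id + ħD -/

section Gauge

open PowerSeries

variable [ChartedSpace (EuclideanSpace ℝ (Fin n)) M] (D : Fn n M →ₗ[ℝ] Fn n M)

theorem component_idAddHbar_one : component (idAddHbar D) 1 = D := by
  ext1 f
  rw [component, ← zero_add 1, coeff_succ_idAddHbar]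
  simp

theorem component_idAddHbar_add_two (i : ℕ) (f : Fn n M) :
    component (idAddHbar D) (i + 2) f = 0 := by
  rw [component, coeff_succ_idAddHbar, coeff_succ_C, coeff_succ_C, map_zero, add_zero]

theorem isGauge_idAddHbar [IsManifold (𝓡 n) ∞ M] (hD : IsDiffOp D) : IsGauge (idAddHbar D) := by
  have h0 : ∀ f, component (idAddHbar D) 0 f = f := fun f => by
    rw [component, coeff_zero_idAddHbar, coeff_zero_C]
  refine ⟨h0, fun i => ?_⟩
  match i with
  | 0 => exact (funext h0 : component (idAddHbar D) 0 = _) ▸ isDiffOp_id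
  | 1 => rwa [component_idAddHbar_one]
  | i + 2 => exact (funext (component_idAddHbar_add_two D i)) ▸ isDiffOp_zero

theorem vanishesOnConstants_idAddHbar (hD : D 1 = 0) : VanishesOnConstants (idAddHbar D) := by
  intro i hi c
  match i with
  | 1 => rw [component_idAddHbar_one, Algebra.algebraMap_eq_smul_one, map_smul, hD, smul_zero]
  | i + 2 => exact component_idAddHbar_add_two D i _

end Gauge

/-! ### Removing the symmetric part -/

namespace StarProduct

variable [T2Space M] [SecondCountableTopology M] [ChartedSpace (EuclideanSpace ℝ (Fin n)) M]
  [IsManifold (𝓡 n) ∞ M] (S : StarProduct n M)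

/-- A star product can be transported along some `id + ħ D`, with `D` a differential operator such
that `D 1 = B_1(1, 1)`, to one with vanishing symmetric part of the first-order operator. -/
theorem exists_transport_B1plus_eq_zero :
    ∃ (D : Fn n M →ₗ[ℝ] Fn n M) (hD : IsDiffOp D), D 1 = S.B 1 1 1 ∧
      ∀ f g, (S.transport D hD).B1plus f g = 0 := by
  obtain ⟨D, hD, h⟩ := exists_isDiffOp_coboundary (B := S.B1plus) (S.bidiff 1).symm S.B1plus_comm
    S.B1plus_cocycle
  refine ⟨D, hD, ?_, fun f g => ?_⟩
  -- At (1, 1) the coboundary is D1 + D1 − D1 = D1, and the symmetrization of `B_1` is `B_1` itself.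
  · have h1 := h 1 1
    rw [B1plus, one_mul, mul_one, mul_one, add_sub_cancel_right, ← two_smul ℝ, smul_smul] at h1
    norm_num at h1
    exact h1.symm
  · have h1 := h f g
    rw [B1plus] at h1 ⊢
    rw [transport_B_one, transport_B_one, mul_comm g f, mul_comm g, mul_comm _ f]
    have h2 : (1 / 2 : ℝ) • (S.B 1 f g - (f * D g + D f * g - D (f * g)) +
        (S.B 1 g f - (D f * g + f * D g - D (f * g)))) =
        (1 / 2 : ℝ) • (S.B 1 f g + S.B 1 g f) - (f * D g + D f * g - D (f * g)) := by
      module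
    rw [h2, h1, sub_self]

end StarProduct

end StarProd

end

theorem proposition3p2 {n : ℕ} {M : Type*} [TopologicalSpace M] [T2Space M]
    [SecondCountableTopology M] [ChartedSpace (EuclideanSpace ℝ (Fin n)) M]
    [IsManifold (𝓡 n) ∞ M] (S : StarProd.StarProduct n M) :
    (∃ S' : StarProd.StarProduct n M,
      StarProd.GaugeEquivalent S S' ∧ ∀ f g, S'.B1plus f g = 0) ∧
    (S.B 1 1 1 = 0 →
      ∃ S' : StarProd.StarProduct n M,
        StarProd.StrictlyGaugeEquivalent S S' ∧ ∀ f g, S'.B1plus f g = 0) := by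
  obtain ⟨D, hD, hD1, h⟩ := S.exists_transport_B1plus_eq_zero
  have hT := StarProd.isGauge_idAddHbar D hD
  have hI := S.intertwines_transport D hD
  exact ⟨⟨S.transport D hD, ⟨_, hT, hI⟩, h⟩, fun h1 => ⟨S.transport D hD,
    ⟨_, hT, StarProd.vanishesOnConstants_idAddHbar D (hD1.trans h1), hI⟩, h⟩⟩
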